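/- Let $V$ be a finite-dimensional complex vector space with a symplectic form $\omega$ (a nondegenerate alternating bilinear form), and let $G$ be a finite group acting linearly on $V$ and preserving $\omega$. Let $S\subset G$ be the set of symplectic reflections, i.e. the elements $s$ for which $1-s$ has rank $2$ on $V$; for $s\in S$ let $\omega_s(x,y)$ be $\omega$ applied to the projections of $x,y\in V$ to $\operatorname{Im}(1-s)$ along $\operatorname{Ker}(1-s)$. Let $\mathbb C[S]^G$ be the space of functions $S\to\mathbb C$ invariant under conjugation by $G$, let $b_1,\dots,b_\ell$ be a basis of it, put $K=\mathbb C[[\hbar_1,\dots,\hbar_\ell]]$ with maximal ideal $\mathfrak m$, and let $c_s=\sum_{i=1}^{\ell}\hbar_i\,b_i(s)\in K$ for $s\in S$ (so $c$ is a formal parameter ranging over $\mathbb C[S]^G$). Let $\mathrm{Weyl}(V)$ be the quotient of the tensor algebra $T(V)$ by the two-sided ideal generated by $xy-yx-\omega(x,y)$, $x,y\in V$. Let $H_c(V,G)$ be the quotient of $(G\ltimes T(V))[[\hbar_1,\dots,\hbar_\ell]]$ by the $\mathfrak m$-adically closed two-sided ideal generated by the relations $$xy-yx=\omega(x,y)-2\sum_{s\in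 S}c_s\,\omega_s(x,y)\,s,\qquad x,y\in V .$$ Then $H_c(V,G)$ is a flat formal deformation of $G\ltimes\mathrm{Weyl}(V)$ over $K$: it is topologically free as a $K$-module, i.e. isomorphic as a $K$-module to $M_0[[\hbar_1,\dots,\hbar_\ell]]$ for some complex vector space $M_0$, and there is an isomorphism of $\mathbb C$-algebras $H_c(V,G)/\mathfrak m H_c(V,G)\cong G\ltimes\mathrm{Weyl}(V)$, which can be taken to send the class of every $x\in V$ to $x$ and the class of every $g\in G$ to $g$. -/

import Mathlib

noncomputable section

namespace FormalDeformation

/-! ### Formal power series in `ℓ` variables and flat formal deformations -/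

/-- The ring `K = k[[ħ₁, …, ħ_ℓ]]`. -/
abbrev FormalRing (k : Type*) (ℓ : ℕ) : Type _ := MvPowerSeries (Fin ℓ) k

/-- The space `M[[ħ₁, …, ħ_ℓ]]` of formal power series with coefficients in a vector space `M`:
the value at `n` is the coefficient of `ħ^n`. -/
def FormalSeries (ℓ : ℕ) (M : Type*) : Type _ := (Fin ℓ →₀ ℕ) → M

namespace FormalSeries

variable {k : Type*} [Field k] {ℓ : ℕ} {M : Type*} [AddCommGroup M] [Module k M]

instance : AddCommGroup (FormalSeries ℓ M) :=
  inferInstanceAs (AddCommGroup ((Fin ℓ →₀ ℕ) → M))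

/-- The coefficient of `ħ^n`. -/
def coeff {ℓ : ℕ} {M : Type*} (n : Fin ℓ →₀ ℕ) (m : FormalSeries ℓ M) : M := m n

theorem ext_coeff {ℓ : ℕ} {M : Type*} {m m' : FormalSeries ℓ M} (h : ∀ n, coeff n m = coeff n m') : m = m' :=
  funext h

theorem coeff_add (n : Fin ℓ →₀ ℕ) (m m' : FormalSeries ℓ M) :
    coeff n (m + m') = coeff n m + coeff n m' := rfl

theorem coeff_zero (n : Fin ℓ →₀ ℕ) : coeff n (0 : FormalSeries ℓ M) = 0 := rfl

/-- The action of power series with scalar coefficients, by the Cauchy product. -/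
instance : SMul (FormalRing k ℓ) (FormalSeries ℓ M) where
  smul f m := fun n =>
    ∑ p ∈ Finset.HasAntidiagonal.antidiagonal n, MvPowerSeries.coeff p.1 f • coeff p.2 m

theorem coeff_smul (n : Fin ℓ →₀ ℕ) (f : FormalRing k ℓ) (m : FormalSeries ℓ M) :
    coeff n (f • m) =
      ∑ p ∈ Finset.HasAntidiagonal.antidiagonal n, MvPowerSeries.coeff p.1 f • coeff p.2 m := rfl

/-- `M[[ħ₁, …, ħ_ℓ]]` is a module over `K`. -/
instance : Module (FormalRing k ℓ) (FormalSeries ℓ M) where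
  one_smul m := by
    classical
    refine ext_coeff fun n => ?_
    rw [coeff_smul, Finset.sum_eq_single (0, n)]
    · simp
    · rintro ⟨a, b⟩ hab hne
      have ha : a ≠ 0 := by
        rintro rfl
        simp at hab
        exact hne (by simp [hab])
      simp [MvPowerSeries.coeff_one, ha]
    · simp
  mul_smul f g m := by
    classical
    refine ext_coeff fun n => ?_
    simp only [coeff_smul, MvPowerSeries.coeff_mul, Finset.sum_smul, Finset.smul_sum, mul_smul]
    rw [Finset.sum_sigma', Finset.sum_sigma']
    refine Finset.sum_nbij' (fun ⟨⟨_, j⟩, ⟨k, l⟩⟩ => ⟨(k, l + j), (l, j)⟩)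
      (fun ⟨⟨i, _⟩, ⟨k, l⟩⟩ => ⟨(i + k, l), (i, k)⟩) ?_ ?_ ?_ ?_ ?_
    · rintro ⟨⟨a, b⟩, ⟨c, d⟩⟩ h
      simp only [Finset.mem_sigma, Finset.HasAntidiagonal.mem_antidiagonal] at h ⊢
      exact ⟨by rw [← add_assoc, h.2, h.1], trivial⟩
    · rintro ⟨⟨a, b⟩, ⟨c, d⟩⟩ h
      simp only [Finset.mem_sigma, Finset.HasAntidiagonal.mem_antidiagonal] at h ⊢
      exact ⟨by rw [add_assoc, h.2, h.1], trivial⟩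
    · rintro ⟨⟨a, b⟩, ⟨c, d⟩⟩ h
      simp only [Finset.mem_sigma, Finset.HasAntidiagonal.mem_antidiagonal] at h
      simp [h.2]
    · rintro ⟨⟨a, b⟩, ⟨c, d⟩⟩ h
      simp only [Finset.mem_sigma, Finset.HasAntidiagonal.mem_antidiagonal] at h
      simp [h.2]
    · rintro ⟨⟨a, b⟩, ⟨c, d⟩⟩ h
      rfl
  smul_zero f := ext_coeff fun n => by simp [coeff_smul, coeff_zero]
  smul_add f m m' := ext_coeff fun n => by
    simp [coeff_smul, coeff_add, smul_add, Finset.sum_add_distrib]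
  add_smul f g m := ext_coeff fun n => by
    simp [coeff_smul, coeff_add, add_smul, Finset.sum_add_distrib]
  zero_smul m := ext_coeff fun n => by simp [coeff_smul, coeff_zero]

end FormalSeries

/-- A `K`-module is topologically free if it is isomorphic to `M₀[[ħ₁, …, ħ_ℓ]]` for some
vector space `M₀`. -/
def IsTopologicallyFree.{u, v} (k : Type u) [Field k] (ℓ : ℕ) (M : Type v) [AddCommGroup M]
    [Module (FormalRing k ℓ) M] : Prop :=
  ∃ (M₀ : Type v) (_ : AddCommGroup M₀) (_ : Module k M₀),
    Nonempty (M ≃ₗ[FormalRing k ℓ] FormalSeries ℓ M₀)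

/-- The ideal `𝔪 A` of a `K`-algebra `A`, where `𝔪` is the maximal ideal of `K`. -/
abbrev maxIdeal (k : Type*) [Field k] (ℓ : ℕ) (A : Type*) [Ring A] [Algebra (FormalRing k ℓ) A] :
    Ideal A :=
  (IsLocalRing.maximalIdeal (FormalRing k ℓ)).map (algebraMap (FormalRing k ℓ) A)

instance maxIdeal_isTwoSided (k : Type*) [Field k] (ℓ : ℕ) (A : Type*) [Ring A]
    [Algebra (FormalRing k ℓ) A] : (maxIdeal k ℓ A).IsTwoSided where
  mul_mem_of_left {a} b ha := by
    induction ha using Submodule.span_induction with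
    | mem x hx =>
      obtain ⟨r, hr, rfl⟩ := hx
      rw [Algebra.commutes]
      exact Ideal.mul_mem_left _ _ (Ideal.mem_map_of_mem _ hr)
    | zero => simp
    | add x y _ _ hx hy => rw [add_mul]; exact Ideal.add_mem _ hx hy
    | smul r x _ hx => rw [smul_eq_mul, mul_assoc]; exact Ideal.mul_mem_left _ _ hx

/-- The data of an `ℓ`-parameter flat formal deformation of the `k`-algebra `A₀` on the
`K`-algebra `A`: `A` is topologically free over `K`, and `φ` is an isomorphism of `k`-algebras
from `A / 𝔪 A` to `A₀` (the `k`-algebra structure of `A / 𝔪 A` comes from `k ⊆ K`). -/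
structure FlatFormalDeformation (k : Type*) [Field k] (ℓ : ℕ) (A₀ : Type*) [Ring A₀]
    [Algebra k A₀] (A : Type*) [Ring A] [Algebra (FormalRing k ℓ) A] where
  topologicallyFree : IsTopologicallyFree k ℓ A
  φ : (A ⧸ maxIdeal k ℓ A) ≃+* A₀
  φ_algebraMap : ∀ z : k,
    φ (Ideal.Quotient.mk _ (algebraMap (FormalRing k ℓ) A (MvPowerSeries.C z))) =
      algebraMap k A₀ z

/-- For a (noncommutative) `k`-algebra `F`, the ring `F[[ħ₁, …, ħ_ℓ]]` with central variables is
an algebra over `K`. -/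
instance formalAlgebra (k : Type*) [Field k] (ℓ : ℕ) (F : Type*) [Ring F] [Algebra k F] :
    Algebra (FormalRing k ℓ) (MvPowerSeries (Fin ℓ) F) :=
  (MvPowerSeries.map (algebraMap k F)).toAlgebra' (by
    classical
    intro c x
    ext n
    rw [MvPowerSeries.coeff_mul, MvPowerSeries.coeff_mul]
    refine Finset.sum_nbij' Prod.swap Prod.swap ?_ ?_ ?_ ?_ ?_
    · simp [add_comm]
    · simp [add_comm]
    · simp
    · simp
    · simp [Algebra.commutes])

/-- A two-sided ideal of `F[[ħ₁, …, ħ_ℓ]]` is closed in the adic topology if it contains every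
series that it approximates to every order, i.e. up to series without terms of degree less
than `N`, for every `N`. -/
def IsAdicallyClosed {ℓ : ℕ} {F : Type*} [Ring F]
    (J : TwoSidedIdeal (MvPowerSeries (Fin ℓ) F)) : Prop :=
  ∀ x : MvPowerSeries (Fin ℓ) F,
    (∀ N : ℕ, ∃ y ∈ J, ∀ n : Fin ℓ →₀ ℕ, n.degree < N →
      MvPowerSeries.coeff n x = MvPowerSeries.coeff n y) → x ∈ J

/-- The adically closed two-sided ideal generated by a set of relations. -/
def closedIdeal {ℓ : ℕ} {F : Type*} [Ring F] (rels : Set (MvPowerSeries (Fin ℓ) F)) :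
    TwoSidedIdeal (MvPowerSeries (Fin ℓ) F) :=
  sInf {J | rels ⊆ (J : Set (MvPowerSeries (Fin ℓ) F)) ∧ IsAdicallyClosed J}

end FormalDeformation

namespace SymplecticReflection

open FormalDeformation

/-! ### Linear actions, the Weyl algebra, and semidirect products -/

section Action

variable (G : Type*) {V : Type*} [Group G] [AddCommGroup V] [Module ℂ V]
  [DistribMulAction G V] [SMulCommClass G ℂ V]

/-- The linear operator by which `g` acts on `V`. -/
abbrev act {G : Type*} (V : Type*) [Group G] [AddCommGroup V] [Module ℂ V]
    [DistribMulAction G V] [SMulCommClass G ℂ V] (g : G) : V →ₗ[ℂ] V :=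
  DistribSMul.toLinearMap ℂ V g

/-- The automorphism of the tensor algebra induced by `g`. -/
def tensorMap {G : Type*} (V : Type*) [Group G] [AddCommGroup V] [Module ℂ V]
    [DistribMulAction G V] [SMulCommClass G ℂ V] (g : G) :
    TensorAlgebra ℂ V →ₐ[ℂ] TensorAlgebra ℂ V :=
  TensorAlgebra.lift ℂ (TensorAlgebra.ι ℂ ∘ₗ act V g)

/-- `G` acts on the tensor algebra `T(V)` by algebra automorphisms. -/
instance tensorAction : MulSemiringAction G (TensorAlgebra ℂ V) where
  smul g a := tensorMap V g a
  one_smul a := by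
    change tensorMap V (1 : G) a = a
    have : tensorMap V (1 : G) = AlgHom.id ℂ _ := by
      ext v; simp [tensorMap]
    rw [this]; rfl
  mul_smul g h a := by
    change tensorMap V (g * h) a = tensorMap V g (tensorMap V h a)
    have : tensorMap V (g * h) = (tensorMap V g).comp (tensorMap V h) := by
      ext v; simp [tensorMap, mul_smul]
    rw [this]; rfl
  smul_zero g := map_zero (tensorMap V g)
  smul_add g := map_add (tensorMap V g)
  smul_one g := map_one (tensorMap V g)
  smul_mul g := map_mul (tensorMap V g)

theorem smul_tensor_def (g : G) (a : TensorAlgebra ℂ V) : g • a = tensorMap V g a := rfl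

instance : SMulCommClass G ℂ (TensorAlgebra ℂ V) where
  smul_comm g z a := map_smul (tensorMap V g) z a

/-- The action of `G` preserves the bilinear form `ω`. -/
class PreservesForm (ω : LinearMap.BilinForm ℂ V) : Prop where
  apply_smul_smul : ∀ (g : G) (x y : V), ω (g • x) (g • y) = ω x y

/-- The defining relations `x y - y x = ω(x, y)` of the Weyl algebra. -/
inductive WeylRel {V : Type*} [AddCommGroup V] [Module ℂ V] (ω : LinearMap.BilinForm ℂ V) :
    TensorAlgebra ℂ V → TensorAlgebra ℂ V → Prop
  | comm (x y : V) : WeylRel ω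
      (TensorAlgebra.ι ℂ x * TensorAlgebra.ι ℂ y - TensorAlgebra.ι ℂ y * TensorAlgebra.ι ℂ x)
      (algebraMap ℂ _ (ω x y))

/-- The Weyl algebra of `(V, ω)`. -/
abbrev Weyl {V : Type*} [AddCommGroup V] [Module ℂ V] (ω : LinearMap.BilinForm ℂ V) : Type _ :=
  RingQuot (WeylRel ω)

/-- The quotient map `T(V) → Weyl(V)`. -/
abbrev Weyl.mk {V : Type*} [AddCommGroup V] [Module ℂ V] (ω : LinearMap.BilinForm ℂ V) :
    TensorAlgebra ℂ V →ₐ[ℂ] Weyl ω :=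
  RingQuot.mkAlgHom ℂ (WeylRel ω)

/-- The automorphism of the Weyl algebra induced by `g`. -/
def weylMap {G : Type*} {V : Type*} [Group G] [AddCommGroup V] [Module ℂ V]
    [DistribMulAction G V] [SMulCommClass G ℂ V] (ω : LinearMap.BilinForm ℂ V)
    [PreservesForm G ω] (g : G) : Weyl ω →ₐ[ℂ] Weyl ω :=
  RingQuot.liftAlgHom ℂ ⟨(Weyl.mk ω).comp (tensorMap V g), by
    rintro _ _ ⟨x, y⟩
    have h := RingQuot.mkAlgHom_rel ℂ (WeylRel.comm (ω := ω) (g • x) (g • y))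
    rw [PreservesForm.apply_smul_smul] at h
    simpa [tensorMap] using h⟩

theorem weylMap_mk (ω : LinearMap.BilinForm ℂ V) [PreservesForm G ω] (g : G)
    (a : TensorAlgebra ℂ V) : weylMap ω g (Weyl.mk ω a) = Weyl.mk ω (g • a) := by
  simp [weylMap, smul_tensor_def]

/-- `G` acts on the Weyl algebra by algebra automorphisms. -/
instance weylAction (ω : LinearMap.BilinForm ℂ V) [PreservesForm G ω] :
    MulSemiringAction G (Weyl ω) where
  smul g a := weylMap ω g a
  one_smul a := by
    change weylMap ω (1 : G) a = a
    obtain ⟨a, rfl⟩ := RingQuot.mkAlgHom_surjective ℂ (WeylRel ω) a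
    rw [weylMap_mk, one_smul]
  mul_smul g h a := by
    change weylMap ω (g * h) a = weylMap ω g (weylMap ω h a)
    obtain ⟨a, rfl⟩ := RingQuot.mkAlgHom_surjective ℂ (WeylRel ω) a
    rw [weylMap_mk, weylMap_mk, weylMap_mk, mul_smul]
  smul_zero g := map_zero (weylMap ω g)
  smul_add g := map_add (weylMap ω g)
  smul_one g := map_one (weylMap ω g)
  smul_mul g := map_mul (weylMap ω g)

instance (ω : LinearMap.BilinForm ℂ V) [PreservesForm G ω] : SMulCommClass G ℂ (Weyl ω) where
  smul_comm g z a := map_smul (weylMap ω g) z a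

/-- The semidirect product `G ⋉ T(V)`; its elements are finite sums of `a g` with `a ∈ T(V)`,
`g ∈ G`, and `g a = (g • a) g`. -/
abbrev SmashTensor (V : Type*) [AddCommGroup V] [Module ℂ V] [DistribMulAction G V]
    [SMulCommClass G ℂ V] : Type _ :=
  SkewMonoidAlgebra (TensorAlgebra ℂ V) G

/-- The semidirect product `G ⋉ Weyl(V)`. -/
abbrev SmashWeyl (ω : LinearMap.BilinForm ℂ V) [PreservesForm G ω] : Type _ :=
  SkewMonoidAlgebra (Weyl ω) G

end Action

/-! ### Symplectic reflections -/

section Reflections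

variable (G : Type*) (V : Type*) [Group G] [AddCommGroup V] [Module ℂ V]
  [DistribMulAction G V] [SMulCommClass G ℂ V]

/-- The set `S` of symplectic reflections: the `g ∈ G` for which `1 - g` has rank `2` on `V`. -/
def reflections : Set G :=
  {g | Module.finrank ℂ (LinearMap.range (1 - act V g)) = 2}

/-- The space `ℂ[S]^G` of conjugation-invariant functions on `S`. -/
def invariantFunctions : Submodule ℂ (reflections G V → ℂ) where
  carrier := {f | ∀ (g : G) (s s' : reflections G V), (s' : G) = g * s * g⁻¹ → f s' = f s}
  add_mem' hf hf' g s s' h := by simp [hf g s s' h, hf' g s s' h]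
  zero_mem' _ _ _ _ := rfl
  smul_mem' z f hf g s s' h := by simp [hf g s s' h]

variable {G} in
theorem isCompl_range_ker [Finite G] [FiniteDimensional ℂ V] (g : G) :
    IsCompl (LinearMap.range (1 - act V g)) (LinearMap.ker (1 - act V g)) := by
  refine (Submodule.isCompl_iff_disjoint _ _ ?_).mpr ?_
  · rw [LinearMap.finrank_range_add_finrank_ker]
  · rw [Submodule.disjoint_def]
    rintro x ⟨y, hy⟩ hx
    have hx' : g • x = x := by
      have : x - g • x = 0 := by simpa using hx
      exact (sub_eq_zero.mp this).symm
    have hy' : g • y = y - x := by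
      have : y - g • y = x := by simpa using hy
      rw [← this]; abel
    have key : ∀ m : ℕ, g ^ m • y = y - (m : ℂ) • x := by
      intro m
      induction m with
      | zero => simp
      | succ m ih =>
        rw [pow_succ', mul_smul, ih, smul_sub, smul_comm g, hx', hy']
        push_cast
        rw [add_smul, one_smul]
        abel
    have h := key (orderOf g)
    rw [pow_orderOf_eq_one, one_smul] at h
    have h0 : (orderOf g : ℂ) • x = 0 := by simpa using h.symm
    have hpos : (orderOf g : ℂ) ≠ 0 := by exact_mod_cast (orderOf_pos g).ne'
    exact (smul_eq_zero.mp h0).resolve_left hpos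

variable {G V} in
/-- The form `ω_s`: the form `ω` applied to the projections of both arguments to the image of
`1 - s` along the kernel of `1 - s`. -/
def reflForm [Finite G] [FiniteDimensional ℂ V] (ω : LinearMap.BilinForm ℂ V) (s : G) (x y : V) :
    ℂ :=
  ω (Submodule.projection _ _ (isCompl_range_ker V s) x)
    (Submodule.projection _ _ (isCompl_range_ker V s) y)

instance [Finite G] : Fintype (reflections G V) := Fintype.ofFinite _

end Reflections

/-! ### The symplectic reflection algebra with formal parameter -/

section Algebra

variable {G V : Type*} [Group G] [AddCommGroup V] [Module ℂ V]
  [DistribMulAction G V] [SMulCommClass G ℂ V] {ℓ : ℕ}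

/-- The formal parameter `c` ranging over `ℂ[S]^G`: for a basis `b₁, …, b_ℓ` of `ℂ[S]^G`, with
`ħ₁, …, ħ_ℓ` as the corresponding coordinates, this is `c = ħ₁ b₁ + ⋯ + ħ_ℓ b_ℓ`. -/
def formalParam (b : Module.Basis (Fin ℓ) ℂ (invariantFunctions G V)) (s : reflections G V) :
    FormalRing ℂ ℓ :=
  ∑ i, (b i : reflections G V → ℂ) s • MvPowerSeries.X i

/-- The element of `(G ⋉ T(V))[[ħ₁, …, ħ_ℓ]]` given by a vector. -/
def vec (G : Type*) {V : Type*} [Group G] [AddCommGroup V] [Module ℂ V]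
    [DistribMulAction G V] [SMulCommClass G ℂ V] (ℓ : ℕ) (x : V) :
    MvPowerSeries (Fin ℓ) (SmashTensor G V) :=
  MvPowerSeries.C (SkewMonoidAlgebra.single 1 (TensorAlgebra.ι ℂ x))

/-- The element of `(G ⋉ T(V))[[ħ₁, …, ħ_ℓ]]` given by a group element. -/
def grp {G : Type*} (V : Type*) [Group G] [AddCommGroup V] [Module ℂ V]
    [DistribMulAction G V] [SMulCommClass G ℂ V] (ℓ : ℕ) (g : G) :
    MvPowerSeries (Fin ℓ) (SmashTensor G V) :=
  MvPowerSeries.C (SkewMonoidAlgebra.single g 1)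

variable [Finite G] [FiniteDimensional ℂ V]

/-- The right-hand side `t ω(x, y) - 2 ∑_{s ∈ S} c_s ω_s(x, y) s` of the commutation relations,
for `t` and `c` with values in `K`. -/
def kappa (ω : LinearMap.BilinForm ℂ V) (t : FormalRing ℂ ℓ)
    (c : reflections G V → FormalRing ℂ ℓ) (x y : V) :
    MvPowerSeries (Fin ℓ) (SmashTensor G V) :=
  t • algebraMap ℂ (MvPowerSeries (Fin ℓ) (SmashTensor G V)) (ω x y)
    - 2 * ∑ s : reflections G V, c s • reflForm ω (s : G) x y • grp V ℓ (s : G)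

/-- The elements `[x, y] - κ(x, y)`, for `x, y ∈ V`. -/
def relations (ω : LinearMap.BilinForm ℂ V) (t : FormalRing ℂ ℓ)
    (c : reflections G V → FormalRing ℂ ℓ) : Set (MvPowerSeries (Fin ℓ) (SmashTensor G V)) :=
  Set.range fun p : V × V =>
    vec G ℓ p.1 * vec G ℓ p.2 - vec G ℓ p.2 * vec G ℓ p.1 - kappa ω t c p.1 p.2

/-- The symplectic reflection algebra `H_c(V, G)` with `t = 1` and formal parameter `c`: the
quotient of `(G ⋉ T(V))[[ħ₁, …, ħ_ℓ]]` by the closed ideal generated by the relations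
`[x, y] = ω(x, y) - 2 ∑_{s ∈ S} c_s ω_s(x, y) s`. -/
abbrev FormalSRA (ω : LinearMap.BilinForm ℂ V)
    (b : Module.Basis (Fin ℓ) ℂ (invariantFunctions G V)) : Type _ :=
  MvPowerSeries (Fin ℓ) (SmashTensor G V) ⧸
    (closedIdeal (relations ω 1 (formalParam b))).asIdeal

/-- The quotient map `(G ⋉ T(V))[[ħ₁, …, ħ_ℓ]] → H_c(V, G)`. -/
abbrev FormalSRA.mk (ω : LinearMap.BilinForm ℂ V)
    (b : Module.Basis (Fin ℓ) ℂ (invariantFunctions G V)) :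
    MvPowerSeries (Fin ℓ) (SmashTensor G V) →+* FormalSRA ω b :=
  Ideal.Quotient.mk _

end Algebra

end SymplecticReflection

end

noncomputable section

namespace SymplecticReflection

/-! ### Normal ordering of linear maps on the tensor algebra. -/

section NormalOrdering

open TensorAlgebra

variable {G V N : Type*} [Group G] [AddCommGroup V] [Module ℂ V]
  [DistribMulAction G V] [SMulCommClass G ℂ V] [AddCommGroup N] [Module ℂ N]

/-! Write A for G ⋉ Weyl(V) and π for the projection G ⋉ T(V) → A. Flatness follows once there is a
linear map θ from G ⋉ T(V) to A[[ħ]] that has constant term π and respects the commutation relations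
of H_c(V, G), multiplied on both sides by arbitrary elements. The continuous extension of θ to power
series kills the closed ideal of relations (`seriesExtend_eq_zero_of_mem_closedIdeal`). Being a
triangular perturbation of π, it is surjective (`seriesExtend_surjective`). Its kernel is no larger
than the closed ideal (`mem_of_seriesExtend_eq_zero`), because every element of ker π is the
constant term of an element of that ideal (`exists_mem_closedIdeal_of_smashProj_eq_zero`). Hence
H_c(V, G) is A[[ħ]] as a K-module, and reduction modulo 𝔪 gives back A.

The map θ comes from a diamond lemma for linear maps instead of rewriting rules
(`exists_normalOrdering`). On words in a basis of V, the values at words without descents are free,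
and the relations force all others by recursion on length and then on a weight. Two descents of one
word must give the same value. For disjoint descents this follows from invariance under conjugation
(`curv_disjoint`), for overlapping ones from the Jacobi identity (`curv_jacobi`). The latter holds
separately for each s: ω_s and 1 - s only see the projection to Im(1 - s), which is a plane
(`curvForm_jacobi`).

Prescribing π on the words without descents makes the constant term of θ equal to π, since both
satisfy the Weyl relations (`eq_of_eq_on_sorted`). No basis of Weyl(V) is needed. -/

theorem smul_ι (g : G) (x : V) : g • (ι ℂ x : TensorAlgebra ℂ V) = ι ℂ (g • x) := by
  simp [smul_tensor_def, tensorMap]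

/-! ### Words in a basis -/

/-- The product of the basis vectors indexed by a list, in the tensor algebra. -/
def word {d : ℕ} (e : Module.Basis (Fin d) ℂ V) (l : List (Fin d)) : TensorAlgebra ℂ V :=
  (l.map fun i => ι ℂ (e i)).prod

section Words

variable {d : ℕ} (e : Module.Basis (Fin d) ℂ V)

@[simp] theorem word_nil : word e [] = 1 := rfl

@[simp] theorem word_cons (i : Fin d) (l : List (Fin d)) :
    word e (i :: l) = ι ℂ (e i) * word e l := by
  simp [word]

@[simp] theorem word_append (l l' : List (Fin d)) : word e (l ++ l') = word e l * word e l' := by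
  simp [word]

theorem tensorAlgebra_basis_apply (l : List (Fin d)) :
    e.tensorAlgebra (FreeMonoid.ofList l) = word e l := by
  simp [Module.Basis.tensorAlgebra, FreeAlgebra.basisFreeMonoid,
    FreeAlgebra.equivMonoidAlgebraFreeMonoid, FreeMonoid.lift_apply, word, map_list_prod,
    Function.comp_def]

/-- The linear map on the tensor algebra with prescribed values on words. -/
def wordExtend (f : List (Fin d) → N) : TensorAlgebra ℂ V →ₗ[ℂ] N :=
  e.tensorAlgebra.constr ℂ fun l => f (FreeMonoid.toList l)

@[simp] theorem wordExtend_word (f : List (Fin d) → N) (l : List (Fin d)) :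
    wordExtend e f (word e l) = f l := by
  rw [← tensorAlgebra_basis_apply, wordExtend, Module.Basis.constr_basis]
  rfl

/-- The span of the words of length `n`, i.e. the tensors of degree `n`. -/
def wordSpan (n : ℕ) : Submodule ℂ (TensorAlgebra ℂ V) :=
  Submodule.span ℂ {a | ∃ l : List (Fin d), l.length = n ∧ word e l = a}

theorem word_mem_wordSpan (l : List (Fin d)) : word e l ∈ wordSpan e l.length :=
  Submodule.subset_span ⟨l, rfl, rfl⟩

theorem mul_mem_wordSpan {m n : ℕ} {p q : TensorAlgebra ℂ V} (hp : p ∈ wordSpan e m)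
    (hq : q ∈ wordSpan e n) : p * q ∈ wordSpan e (m + n) := by
  induction hp, hq using Submodule.span_induction₂ with
  | mem_mem x y hx hy =>
    obtain ⟨l, rfl, rfl⟩ := hx
    obtain ⟨l', rfl, rfl⟩ := hy
    rw [← word_append, ← List.length_append]
    exact word_mem_wordSpan e _
  | zero_left => simp
  | zero_right => simp
  | add_left x y z _ _ _ h h' => rw [add_mul]; exact add_mem h h'
  | add_right x y z _ _ _ h h' => rw [mul_add]; exact add_mem h h'
  | smul_left r x y _ _ h => rw [smul_mul_assoc]; exact Submodule.smul_mem _ _ h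
  | smul_right r x y _ _ h => rw [mul_smul_comm]; exact Submodule.smul_mem _ _ h

theorem ι_mem_wordSpan (x : V) : ι ℂ x ∈ wordSpan e 1 := by
  rw [← e.sum_repr x, map_sum]
  refine Submodule.sum_mem _ fun i _ => ?_
  rw [map_smul]
  refine Submodule.smul_mem _ _ ?_
  simpa using word_mem_wordSpan e [i]

theorem smul_mem_wordSpan (g : G) {n : ℕ} {p : TensorAlgebra ℂ V} (hp : p ∈ wordSpan e n) :
    g • p ∈ wordSpan e n := by
  induction hp using Submodule.span_induction with
  | mem x hx =>
    obtain ⟨l, rfl, rfl⟩ := hx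
    induction l with
    | nil => rw [word_nil, smul_one]; exact word_mem_wordSpan e []
    | cons i l ih =>
      rw [word_cons, smul_mul', smul_ι, List.length_cons, add_comm]
      exact mul_mem_wordSpan e (ι_mem_wordSpan e _) ih
  | zero => simp
  | add x y _ _ h h' => rw [smul_add]; exact add_mem h h'
  | smul r x _ h => rw [smul_comm]; exact Submodule.smul_mem _ _ h

theorem word_induction {P : TensorAlgebra ℂ V → Prop} (p : TensorAlgebra ℂ V)
    (word : ∀ l, P (word e l)) (zero : P 0) (add : ∀ a b, P a → P b → P (a + b))
    (smul : ∀ (z : ℂ) a, P a → P (z • a)) : P p := by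
  have h : p ∈ Submodule.span ℂ (Set.range e.tensorAlgebra) := by
    rw [e.tensorAlgebra.span_eq]; trivial
  induction h using Submodule.span_induction with
  | mem x hx =>
    obtain ⟨l, rfl⟩ := hx
    have := word (FreeMonoid.toList l)
    rwa [← tensorAlgebra_basis_apply] at this
  | zero => exact zero
  | add x y _ _ h h' => exact add _ _ h h'
  | smul r x _ h => exact smul _ _ h

/-- This locality in the degree is what lets normal ordering be defined recursively: a value on
homogeneous tensors uses only words of that length. -/
theorem wordExtend_congr {f f' : List (Fin d) → N} {n : ℕ} (h : ∀ l, l.length = n → f l = f' l)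
    {p : TensorAlgebra ℂ V} (hp : p ∈ wordSpan e n) : wordExtend e f p = wordExtend e f' p := by
  induction hp using Submodule.span_induction with
  | mem x hx =>
    obtain ⟨l, hl, rfl⟩ := hx
    simp [h l hl]
  | zero => simp
  | add x y _ _ h h' => rw [map_add, map_add, h, h']
  | smul r x _ h => rw [map_smul, map_smul, h]

end Words

/-! ### Descents of words -/

/-- A weight on words that drops whenever a descent is transposed. -/
def wordWeight {d : ℕ} : List (Fin d) → ℕ
  | [] => 0
  -- A letter is weighted by its distance from the end, so moving the larger of two neighbours to
  -- the right lowers the total.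
  | i :: l => (l.length + 1) * i + wordWeight l

/-- Transposing neighbours leaves the other positions alone, so the weight drops by exactly x - y.
-/
theorem wordWeight_swap_lt {d : ℕ} (a b : List (Fin d)) {x y : Fin d} (h : y < x) :
    wordWeight (a ++ y :: x :: b) < wordWeight (a ++ x :: y :: b) := by
  induction a with
  | nil =>
    simp only [List.nil_append, wordWeight, List.length_cons]
    have : (y : ℕ) < x := h
    nlinarith
  | cons i a ih => simpa [wordWeight] using ih

/-- `(a, x, y, b)` is a descent of `w` if `w = a x y b` with `x > y`. -/
def IsDescent {d : ℕ} (w a : List (Fin d)) (x y : Fin d) (b : List (Fin d)) : Prop :=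
  w = a ++ x :: y :: b ∧ y < x

/-- Any two descents of a word coincide, overlap in one letter, or are disjoint. -/
theorem IsDescent.cases {d : ℕ} {w a a' b b' : List (Fin d)} {x y x' y' : Fin d}
    (h : IsDescent w a x y b) (h' : IsDescent w a' x' y' b') (hle : a.length ≤ a'.length) :
    (a = a' ∧ x = x' ∧ y = y' ∧ b = b') ∨
      (a' = a ++ [x] ∧ x' = y ∧ b = y' :: b') ∨
      ∃ c, a' = a ++ x :: y :: c ∧ b = c ++ x' :: y' :: b' := by
  have e := h.1.symm.trans h'.1
  obtain ⟨t, rfl⟩ : ∃ t, a' = a ++ t := by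
    rcases List.append_eq_append_iff.mp e with ⟨t, h1, _⟩ | ⟨t, h1, _⟩
    · exact ⟨t, h1⟩
    · have : t = [] := by
        rw [h1, List.length_append] at hle
        exact List.length_eq_zero_iff.mp (by omega)
      exact ⟨[], by simp [h1, this]⟩
  rw [List.append_assoc, List.append_cancel_left_eq] at e
  match t, e with
  | [], e => left; simpa using e
  | [u], e => right; left; simp at e; simp [e]
  | u :: v :: c, e => right; right; simp at e; exact ⟨c, by simp [e], by simp [e]⟩

/-- The data for commutation relations `[x, y] = ∑ μ_s β_s(x, y) s` in which the coefficients
`μ_s` act on a vector space `N`, on which `G` acts from the right by `ρ`. -/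
structure CurvatureData (G V N : Type*) [Group G] [AddCommGroup V] [Module ℂ V]
    [DistribMulAction G V] [AddCommGroup N] [Module ℂ N] where
  /-- the bilinear form at `s` -/
  form : G → LinearMap.BilinForm ℂ V
  /-- the coefficient of `s` -/
  coef : G → Module.End ℂ N
  /-- the right action of `G` -/
  ract : G → Module.End ℂ N
  form_alt : ∀ s x, form s x x = 0
  form_conj : ∀ g s x y, form (g * s * g⁻¹) (g • x) (g • y) = form s x y
  jacobi : ∀ s x y z, form s x y • (s • z - z) + form s y z • (s • x - x) +
    form s z x • (s • y - y) = 0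
  coef_conj : ∀ g s, coef (g * s * g⁻¹) = coef s
  coef_comm : ∀ s r n, coef s (coef r n) = coef r (coef s n)
  coef_ract : ∀ s r n, ract r (coef s n) = coef s (ract r n)
  ract_mul : ∀ g h n, ract (g * h) n = ract h (ract g n)

/-! ### Commutation relations imposed on linear maps, and their ambiguities. -/

namespace CurvatureData

theorem form_neg {G V N : Type*} [Group G] [AddCommGroup V] [Module ℂ V] [DistribMulAction G V]
    [AddCommGroup N] [Module ℂ N] (D : CurvatureData G V N) (s : G) (x y : V) : D.form s y x = - D.form s x y := by
  have h := D.form_alt s (x + y)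
  simp only [map_add, LinearMap.add_apply, D.form_alt, zero_add, add_zero] at h
  exact eq_neg_of_add_eq_zero_left h

variable [Fintype G] (D : CurvatureData G V N)

/-- The value at `p [x, y] q` forced on a linear map by the commutation relations. -/
def curv (f : TensorAlgebra ℂ V →ₗ[ℂ] N) (p : TensorAlgebra ℂ V) (x y : V)
    (q : TensorAlgebra ℂ V) : N :=
  -- In G ⋉ T(V) one has p s q = p (s • q) s; the trailing s becomes the right action on `N`.
  ∑ s, D.coef s (D.ract s (D.form s x y • f (p * s • q)))

/-- The commutation relation at `p [x, y] q`. -/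
def Holds (f : TensorAlgebra ℂ V →ₗ[ℂ] N) (p : TensorAlgebra ℂ V) (x y : V)
    (q : TensorAlgebra ℂ V) : Prop :=
  f (p * (ι ℂ x * ι ℂ y - ι ℂ y * ι ℂ x) * q) = D.curv f p x y q

section Linearity

variable (f : TensorAlgebra ℂ V →ₗ[ℂ] N)

theorem curv_self (p : TensorAlgebra ℂ V) (x : V) (q : TensorAlgebra ℂ V) :
    D.curv f p x x q = 0 := by
  simp [curv, D.form_alt]

theorem curv_swap (p : TensorAlgebra ℂ V) (x y : V) (q : TensorAlgebra ℂ V) :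
    D.curv f p y x q = - D.curv f p x y q := by
  simp [curv, D.form_neg _ x y]

theorem curv_add_left (p p' : TensorAlgebra ℂ V) (x y : V) (q : TensorAlgebra ℂ V) :
    D.curv f (p + p') x y q = D.curv f p x y q + D.curv f p' x y q := by
  simp [curv, add_mul, Finset.sum_add_distrib]

theorem curv_smul_left (z : ℂ) (p : TensorAlgebra ℂ V) (x y : V) (q : TensorAlgebra ℂ V) :
    D.curv f (z • p) x y q = z • D.curv f p x y q := by
  simp [curv, Finset.smul_sum, smul_comm z]

theorem curv_add_right (p : TensorAlgebra ℂ V) (x y : V) (q q' : TensorAlgebra ℂ V) :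
    D.curv f p x y (q + q') = D.curv f p x y q + D.curv f p x y q' := by
  simp [curv, mul_add, Finset.sum_add_distrib]

theorem curv_smul_right (z : ℂ) (p : TensorAlgebra ℂ V) (x y : V) (q : TensorAlgebra ℂ V) :
    D.curv f p x y (z • q) = z • D.curv f p x y q := by
  simp [curv, Finset.smul_sum, smul_comm _ z]

theorem curv_add_fst (p : TensorAlgebra ℂ V) (x x' y : V) (q : TensorAlgebra ℂ V) :
    D.curv f p (x + x') y q = D.curv f p x y q + D.curv f p x' y q := by
  simp [curv, add_smul, Finset.sum_add_distrib]

theorem curv_smul_fst (z : ℂ) (p : TensorAlgebra ℂ V) (x y : V) (q : TensorAlgebra ℂ V) :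
    D.curv f p (z • x) y q = z • D.curv f p x y q := by
  simp [curv, Finset.smul_sum, mul_smul]

variable {f}

theorem Holds.swap {p q : TensorAlgebra ℂ V} {x y : V} (h : D.Holds f p x y q) :
    D.Holds f p y x q := by
  rw [Holds, curv_swap, ← h, ← map_neg, ← neg_mul, ← mul_neg, neg_sub]

theorem holds_self (p q : TensorAlgebra ℂ V) (x : V) : D.Holds f p x x q := by
  simp [Holds, curv_self]

theorem Holds.of_span_left {S : Set (TensorAlgebra ℂ V)} {p q : TensorAlgebra ℂ V} {x y : V}
    (h : ∀ p ∈ S, D.Holds f p x y q) (hp : p ∈ Submodule.span ℂ S) : D.Holds f p x y q := by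
  induction hp using Submodule.span_induction with
  | mem p hp => exact h p hp
  | zero => simp [Holds, curv]
  | add a b _ _ ha hb =>
    rw [Holds, curv_add_left, ← ha, ← hb, add_mul, add_mul, map_add]
  | smul z a _ ha => rw [Holds, curv_smul_left, ← ha, smul_mul_assoc, smul_mul_assoc, map_smul]

theorem Holds.of_span_right {S : Set (TensorAlgebra ℂ V)} {p q : TensorAlgebra ℂ V} {x y : V}
    (h : ∀ q ∈ S, D.Holds f p x y q) (hq : q ∈ Submodule.span ℂ S) : D.Holds f p x y q := by
  induction hq using Submodule.span_induction with
  | mem p hp => exact h p hp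
  | zero => simp [Holds, curv]
  | add a b _ _ ha hb =>
    rw [Holds, curv_add_right, ← ha, ← hb, mul_add, map_add]
  | smul z a _ ha => rw [Holds, curv_smul_right, ← ha, mul_smul_comm, map_smul]

theorem Holds.of_span_fst {S : Set V} {p q : TensorAlgebra ℂ V} {x y : V}
    (h : ∀ x ∈ S, D.Holds f p x y q) (hx : x ∈ Submodule.span ℂ S) : D.Holds f p x y q := by
  induction hx using Submodule.span_induction with
  | mem p hp => exact h p hp
  | zero => simp [Holds, curv]
  | add a b _ _ ha hb =>
    rw [Holds, curv_add_fst, ← ha, ← hb, ← map_add, ← add_mul, ← mul_add]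
    congr 3
    simp only [map_add, add_mul, mul_add]
    abel
  | smul z a _ ha =>
    rw [Holds, curv_smul_fst, ← ha, ← map_smul, ← smul_mul_assoc, ← mul_smul_comm]
    simp only [map_smul, smul_mul_assoc, mul_smul_comm, smul_sub]

/-- It suffices to check the commutation relations on words. -/
theorem Holds.of_words {d : ℕ} (e : Module.Basis (Fin d) ℂ V) {m n : ℕ}
    (h : ∀ (a b : List (Fin d)) (x y : Fin d), a.length = m → b.length = n → y < x →
      D.Holds f (word e a) (e x) (e y) (word e b))
    {p q : TensorAlgebra ℂ V} (hp : p ∈ wordSpan e m) (hq : q ∈ wordSpan e n) (x y : V) :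
    D.Holds f p x y q := by
  refine Holds.of_span_left D ?_ hp
  rintro _ ⟨a, ha, rfl⟩
  refine Holds.of_span_right D ?_ hq
  rintro _ ⟨b, hb, rfl⟩
  -- Both sides of the relation alternate in the two vectors, so strict descents cover all pairs of
  -- basis vectors.
  have key : ∀ i j, D.Holds f (word e a) (e i) (e j) (word e b) := by
    intro i j
    rcases lt_trichotomy j i with hij | rfl | hij
    · exact h a b i j ha hb hij
    · exact D.holds_self _ _ _
    · exact Holds.swap D (h a b j i ha hb hij)
  have hx : x ∈ Submodule.span ℂ (Set.range e) := by rw [e.span_eq]; trivial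
  have hy : y ∈ Submodule.span ℂ (Set.range e) := by rw [e.span_eq]; trivial
  refine Holds.of_span_fst D ?_ hx
  rintro _ ⟨i, rfl⟩
  refine Holds.swap D (Holds.of_span_fst D ?_ hy)
  rintro _ ⟨j, rfl⟩
  exact key j i

end Linearity

section Ambiguities

variable {f : TensorAlgebra ℂ V →ₗ[ℂ] N}

/-- Resolution of the overlap of two descents, by the Jacobi identity. -/
theorem curv_jacobi (p q : TensorAlgebra ℂ V) (x y z : V) :
    D.curv f p x y (ι ℂ z * q) + D.curv f (p * ι ℂ y) x z q + D.curv f p y z (ι ℂ x * q) =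
      D.curv f (p * ι ℂ x) y z q + D.curv f p x z (ι ℂ y * q) + D.curv f (p * ι ℂ z) x y q := by
  simp only [curv, ← Finset.sum_add_distrib]
  refine Finset.sum_congr rfl fun s _ => ?_
  simp only [← map_add, smul_mul', smul_ι]
  congr 2
  -- Moving s past a letter replaces v by s • v, so the difference of the two sides at s is the
  -- Jacobi expression inserted between p and s • q.
  have h := congrArg (fun v => f (p * ι ℂ v * s • q)) (D.jacobi s x y z)
  simp only [map_add, map_smul, map_sub, mul_add, add_mul, mul_sub, sub_mul, mul_smul_comm,
    smul_mul_assoc, map_zero, mul_zero, zero_mul, D.form_neg s x z, mul_assoc] at h ⊢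
  rw [← sub_eq_zero, ← h]
  module

/-- Two disjoint descents can be resolved in either order. -/
theorem curv_disjoint {p c q : TensorAlgebra ℂ V} {x y u v : V}
    (h₁ : ∀ s : G, D.Holds f (p * s • c) (s • u) (s • v) (s • q))
    (h₂ : ∀ s : G, D.Holds f p x y (c * s • q)) :
    D.curv f p x y (c * (ι ℂ u * ι ℂ v - ι ℂ v * ι ℂ u) * q) =
      D.curv f (p * (ι ℂ x * ι ℂ y - ι ℂ y * ι ℂ x) * c) u v q := by
  have e₁ : ∀ s : G, f (p * s • (c * (ι ℂ u * ι ℂ v - ι ℂ v * ι ℂ u) * q)) =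
      ∑ r, D.coef r (D.ract (s * r * s⁻¹) (D.form r u v • f (p * s • (c * r • q)))) := by
    intro s
    have := h₁ s
    -- The inner relation is at s • u and s • v; reindexing by r ↦ s r s⁻¹ turns its forms back into
    -- those at u and v.
    rw [Holds, curv, ← (MulAut.conj s).toEquiv.sum_comp] at this
    simp only [MulEquiv.toEquiv_eq_coe, EquivLike.coe_coe, MulAut.conj_apply, D.form_conj,
      D.coef_conj, smul_smul, inv_mul_cancel_right] at this
    simp only [smul_mul', smul_sub, smul_ι, mul_assoc, smul_smul] at this ⊢
    exact this
  have e₂ : ∀ r : G, f (p * (ι ℂ x * ι ℂ y - ι ℂ y * ι ℂ x) * c * r • q) =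
      ∑ s, D.coef s (D.ract s (D.form s x y • f (p * s • (c * r • q)))) := by
    intro r
    have := h₂ r
    rwa [Holds, curv, ← mul_assoc] at this
  simp only [curv, e₁, e₂, map_sum, Finset.smul_sum]
  rw [Finset.sum_comm]
  refine Finset.sum_congr rfl fun r _ => Finset.sum_congr rfl fun s _ => ?_
  -- In both orders the accumulated right action is that of s r, since (s r s⁻¹) s = s r.
  simp only [map_smul, D.coef_ract, ← D.ract_mul, inv_mul_cancel_right]
  rw [D.coef_comm, smul_comm]

end Ambiguities

end CurvatureData

/-- Words are compared first by length, then by weight. -/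
def WordLT {d : ℕ} (w' w : List (Fin d)) : Prop :=
  Prod.Lex (· < ·) (· < ·) (w'.length, wordWeight w') (w.length, wordWeight w)

theorem wordLT_wf {d : ℕ} : WellFounded (WordLT (d := d)) :=
  InvImage.wf (fun w : List (Fin d) => (w.length, wordWeight w))
    (WellFounded.prod_lex wellFounded_lt wellFounded_lt)

theorem IsDescent.wordLT {d : ℕ} {w a b : List (Fin d)} {x y : Fin d} (h : IsDescent w a x y b) :
    WordLT (a ++ y :: x :: b) w := by
  obtain ⟨rfl, hlt⟩ := h
  have hl : (a ++ y :: x :: b).length = (a ++ x :: y :: b).length := by simp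
  rw [WordLT, hl]
  exact Prod.Lex.right _ (wordWeight_swap_lt a b hlt)

namespace CurvatureData

variable [Fintype G] (D : CurvatureData G V N) {d : ℕ} (e : Module.Basis (Fin d) ℂ V)

open Classical in
/-- One step of normal ordering: transpose a descent of `w`, if there is one. -/
def orderStep (f₀ f : List (Fin d) → N) (w : List (Fin d)) : N :=
  if h : ∃ t : List (Fin d) × Fin d × Fin d × List (Fin d),
      IsDescent w t.1 t.2.1 t.2.2.1 t.2.2.2 then
    f (h.choose.1 ++ h.choose.2.2.1 :: h.choose.2.1 :: h.choose.2.2.2) +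
      D.curv (wordExtend e f) (word e h.choose.1) (e h.choose.2.1) (e h.choose.2.2.1)
        (word e h.choose.2.2.2)
  else f₀ w

/-- G acts on tensors degree by degree, so the correction produced by a descent involves only words
two letters shorter. -/
theorem curv_congr {f f' : List (Fin d) → N} {n : ℕ} (h : ∀ l, l.length = n → f l = f' l)
    (a b : List (Fin d)) (hn : a.length + b.length = n) (x y : V) :
    D.curv (wordExtend e f) (word e a) x y (word e b) =
      D.curv (wordExtend e f') (word e a) x y (word e b) := by
  refine Finset.sum_congr rfl fun s _ => ?_
  rw [wordExtend_congr e h]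
  rw [← hn]
  exact mul_mem_wordSpan e (word_mem_wordSpan e a) (smul_mem_wordSpan e s (word_mem_wordSpan e b))

/-- Well-foundedness of the recursion: the transposed word has the same length and smaller weight,
and the correction uses shorter words. -/
theorem orderStep_congr (f₀ : List (Fin d) → N) {f f' : List (Fin d) → N} {w : List (Fin d)}
    (h : ∀ w', WordLT w' w → f w' = f' w') : D.orderStep e f₀ f w = D.orderStep e f₀ f' w := by
  unfold orderStep
  split_ifs with hw
  · have hd := hw.choose_spec
    rw [h _ hd.wordLT, D.curv_congr e (fun l hl => h l ?_) _ _ rfl]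
    refine Prod.Lex.left _ _ ?_
    rw [hl]
    conv_rhs => rw [hd.1]
    simp
  · rfl

theorem exists_orderStep_fixed (f₀ : List (Fin d) → N) :
    ∃ f : List (Fin d) → N, ∀ w, f w = D.orderStep e f₀ f w := by
  classical
  refine ⟨wordLT_wf.fix fun w ih =>
    -- The default 0 is never seen, because the step at w reads only words below w.
    D.orderStep e f₀ (fun w' => if h : WordLT w' w then ih w' h else 0) w, fun w => ?_⟩
  rw [WellFounded.fix_eq]
  exact D.orderStep_congr e f₀ fun w' h => dif_pos h

/-- A fixed point of the ordering step transforms correctly under every transposition of a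
descent, whichever descent the step chose. -/
theorem fixed_descent {f₀ f : List (Fin d) → N} (hf : ∀ w, f w = D.orderStep e f₀ f w) {n : ℕ}
    (low : ∀ i j, i + j + 2 < n → ∀ p ∈ wordSpan e i, ∀ q ∈ wordSpan e j, ∀ x y,
      D.Holds (wordExtend e f) p x y q)
    (w : List (Fin d)) (hw : w.length = n) {a b : List (Fin d)} {x y : Fin d}
    (h : IsDescent w a x y b) :
    f w = f (a ++ y :: x :: b) + D.curv (wordExtend e f) (word e a) (e x) (e y) (word e b) := by
  induction hk : wordWeight w using Nat.strong_induction_on generalizing w a b x y with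
  | _ k ih =>
    subst hk
    have ih' : ∀ {a b : List (Fin d)} {x y : Fin d}, (a ++ x :: y :: b).length = n → y < x →
        wordWeight (a ++ x :: y :: b) < wordWeight w → f (a ++ x :: y :: b) =
        f (a ++ y :: x :: b) + D.curv (wordExtend e f) (word e a) (e x) (e y) (word e b) :=
      fun hl hlt hwt => ih _ hwt _ hl ⟨rfl, hlt⟩ rfl
    -- Confluence: any two descents of w predict the same value, given the claim for words of the
    -- same length and smaller weight.
    have confl : ∀ {a b a' b' : List (Fin d)} {x y x' y' : Fin d}, IsDescent w a x y b →
        IsDescent w a' x' y' b' → a.length ≤ a'.length →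
        f (a ++ y :: x :: b) + D.curv (wordExtend e f) (word e a) (e x) (e y) (word e b) =
        f (a' ++ y' :: x' :: b') +
          D.curv (wordExtend e f) (word e a') (e x') (e y') (word e b') := by
      intro a b a' b' x y x' y' h h' hle
      rcases h.cases h' hle with ⟨rfl, rfl, rfl, rfl⟩ | ⟨rfl, rfl, rfl⟩ | ⟨c, rfl, rfl⟩
      · rfl
      · obtain ⟨rfl, hxy⟩ := h
        have hyz := h'.2
        have w₁ := wordWeight_swap_lt a (y' :: b') hxy
        have w₁' := wordWeight_swap_lt (a ++ [x]) b' hyz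
        have w₂ := wordWeight_swap_lt (a ++ [x']) b' (hyz.trans hxy)
        have w₂' := wordWeight_swap_lt a (x' :: b') (hyz.trans hxy)
        -- The overlap is x > x' > y'. Both routes end at the reversed triple y' x' x: one by `e₁`
        -- and `e₂`, the other by `e₃` and `e₄`. The corrections they collect agree by
        -- `curv_jacobi`.
        have e₁ := ih' (a := a ++ [x']) (b := b') (x := x) (y := y')
          (by simpa using hw) (hyz.trans hxy) (by simpa using w₁)
        have e₂ := ih' (a := a) (b := x :: b') (x := x') (y := y')
          (by simpa using hw) hyz (by simp only [List.append_assoc, List.cons_append,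
            List.nil_append] at w₁ w₁' w₂ w₂' ⊢; omega)
        have e₃ := ih' (a := a) (b := x' :: b') (x := x) (y := y')
          (by simpa using hw) (hyz.trans hxy) (by simpa using w₁')
        have e₄ := ih' (a := a ++ [y']) (b := b') (x := x) (y := x')
          (by simpa using hw) hxy (by simp only [List.append_assoc, List.cons_append,
            List.nil_append] at w₁ w₁' w₂ w₂' ⊢; omega)
        have J := D.curv_jacobi (f := wordExtend e f) (word e a) (word e b') (e x) (e x') (e y')
        simp only [List.append_assoc, List.cons_append, List.nil_append, word_append, word_cons,
          word_nil, mul_one] at e₁ e₂ e₃ e₄ ⊢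
        rw [e₁, e₂, e₃, e₄]
        rw [← sub_eq_zero] at J ⊢
        rw [← J]
        abel
      · obtain ⟨rfl, hxy⟩ := h
        have huv := h'.2
        have e₁ := ih' (a := a ++ y :: x :: c) (b := b') (x := x') (y := y')
          (by simpa using hw) huv
          (by simpa using wordWeight_swap_lt a (c ++ x' :: y' :: b') hxy)
        have e₂ := ih' (a := a) (b := c ++ y' :: x' :: b') (x := x) (y := y)
          (by simpa using hw) hxy
          (by simpa using wordWeight_swap_lt (a ++ x :: y :: c) b' huv)
        have hl : a.length + c.length + b'.length + 4 = n := by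
          rw [← hw]; simp; omega
        -- Carrying out both transpositions leaves the corrections to compare. The relations needed
        -- for that are at degree n - 2, two below the present word, hence covered by `low`.
        have J := D.curv_disjoint (f := wordExtend e f) (p := word e a) (c := word e c)
          (q := word e b') (x := e x) (y := e y) (u := e x') (v := e y')
          (fun s => low (a.length + c.length) b'.length (by omega) _
            (mul_mem_wordSpan e (word_mem_wordSpan e a)
              (smul_mem_wordSpan e s (word_mem_wordSpan e c))) _
            (smul_mem_wordSpan e s (word_mem_wordSpan e b')) _ _)
          (fun s => low a.length (c.length + b'.length) (by omega) _ (word_mem_wordSpan e a) _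
            (mul_mem_wordSpan e (word_mem_wordSpan e c)
              (smul_mem_wordSpan e s (word_mem_wordSpan e b'))) _ _)
        have hR : ∀ q q', D.curv (wordExtend e f) (word e a) (e x) (e y) (q - q') =
            D.curv (wordExtend e f) (word e a) (e x) (e y) q -
              D.curv (wordExtend e f) (word e a) (e x) (e y) q' := fun q q' =>
          eq_sub_of_add_eq (by rw [← D.curv_add_right, sub_add_cancel])
        have hL : ∀ p p', D.curv (wordExtend e f) (p - p') (e x') (e y') (word e b') =
            D.curv (wordExtend e f) p (e x') (e y') (word e b') -
              D.curv (wordExtend e f) p' (e x') (e y') (word e b') := fun q q' =>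
          eq_sub_of_add_eq (by rw [← D.curv_add_left, sub_add_cancel])
        simp only [mul_sub, sub_mul, hR, hL] at J
        simp only [List.append_assoc, List.cons_append, word_append, word_cons,
          mul_assoc] at e₁ e₂ J ⊢
        rw [e₁, e₂]
        rw [← sub_eq_zero] at J ⊢
        rw [← J]
        abel
    -- The step used some chosen descent; confluence compares it with the given one, whichever of
    -- the two starts further left.
    have hex : ∃ t : List (Fin d) × Fin d × Fin d × List (Fin d),
      IsDescent w t.1 t.2.1 t.2.2.1 t.2.2.2 := ⟨(a, x, y, b), h⟩
    rw [hf w, orderStep, dif_pos hex]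
    rcases le_total hex.choose.1.length a.length with hle | hle
    · exact confl hex.choose_spec h hle
    · exact (confl h hex.choose_spec hle).symm

/-- **Normal ordering**: a linear map on the tensor algebra that satisfies the commutation
relations can be prescribed arbitrarily on the words without descents. -/
theorem exists_normalOrdering (f₀ : List (Fin d) → N) :
    ∃ f : TensorAlgebra ℂ V →ₗ[ℂ] N,
      (∀ w, (∀ a x y b, ¬ IsDescent w a x y b) → f (word e w) = f₀ w) ∧
      ∀ p x y q, D.Holds f p x y q := by
  obtain ⟨f, hf⟩ := D.exists_orderStep_fixed e f₀
  refine ⟨wordExtend e f, fun w hw => ?_, fun p x y q => ?_⟩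
  · rw [wordExtend_word, hf, orderStep, dif_neg]
    rintro ⟨t, ht⟩
    exact hw _ _ _ _ ht
  -- Induction on the total degree n: the lower relations are what `fixed_descent` needs to resolve
  -- disjoint descents.
  · have key : ∀ n i j, i + j + 2 = n → ∀ p ∈ wordSpan e i, ∀ q ∈ wordSpan e j, ∀ x y,
        D.Holds (wordExtend e f) p x y q := by
      intro n
      induction n using Nat.strong_induction_on with
      | _ n ih =>
        intro i j hij p hp q hq x y
        refine Holds.of_words D e ?_ hp hq x y
        intro a b x y ha hb hxy
        have := D.fixed_descent e hf (n := n) (fun i j h => ih _ h i j rfl)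
          (a ++ x :: y :: b) (by simp; omega) ⟨rfl, hxy⟩
        have e₁ : wordExtend e f (word e (a ++ x :: y :: b)) = _ := wordExtend_word e f _
        have e₂ : wordExtend e f (word e (a ++ y :: x :: b)) = _ := wordExtend_word e f _
        rw [← e₁, ← e₂] at this
        rw [Holds, mul_sub, sub_mul, map_sub, sub_eq_iff_eq_add, add_comm]
        simpa [mul_assoc] using this
    have span_top : ∀ p : TensorAlgebra ℂ V, p ∈ Submodule.span ℂ (Set.range (word e)) :=
      fun p => word_induction e p (fun l => Submodule.subset_span ⟨l, rfl⟩)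
        (zero_mem _) (fun _ _ => add_mem) fun z _ => Submodule.smul_mem _ z
    refine Holds.of_span_left D ?_ (span_top p)
    rintro _ ⟨a, rfl⟩
    refine Holds.of_span_right D ?_ (span_top q)
    rintro _ ⟨b, rfl⟩
    exact key _ _ _ rfl _ (word_mem_wordSpan e a) _ (word_mem_wordSpan e b) x y

end CurvatureData

/-- Two linear maps on the tensor algebra that satisfy the relations `[x, y] = ω(x, y)` agree
if they agree on the words without descents. -/
theorem eq_of_eq_on_sorted {d : ℕ} (e : Module.Basis (Fin d) ℂ V) (ω : LinearMap.BilinForm ℂ V)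
    (f f' : TensorAlgebra ℂ V →ₗ[ℂ] N)
    (hf : ∀ p x y q, f (p * (ι ℂ x * ι ℂ y - ι ℂ y * ι ℂ x) * q) = ω x y • f (p * q))
    (hf' : ∀ p x y q, f' (p * (ι ℂ x * ι ℂ y - ι ℂ y * ι ℂ x) * q) = ω x y • f' (p * q))
    (h : ∀ w, (∀ a x y b, ¬ IsDescent w a x y b) → f (word e w) = f' (word e w)) : f = f' := by
  have key : ∀ w, f (word e w) = f' (word e w) := by
    intro w
    induction w using wordLT_wf.induction with
    | _ w ih =>
      by_cases hw : ∀ a x y b, ¬ IsDescent w a x y b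
      · exact h w hw
      · push Not at hw
        obtain ⟨a, x, y, b, hd⟩ := hw
        have h₁ := ih _ hd.wordLT
        -- The relation at the descent expresses w through the transposed word and this word with
        -- the two letters deleted; both precede w.
        have h₂ := ih (a ++ b) (Prod.Lex.left _ _ (by rw [hd.1]; simp))
        have h₃ := hf (word e a) (e x) (e y) (word e b)
        have h₄ := hf' (word e a) (e x) (e y) (word e b)
        rw [← word_append, h₂, word_append, ← h₄, mul_sub, sub_mul, map_sub, map_sub] at h₃
        simp only [word_append, word_cons, ← mul_assoc] at h₁ h₃
        rw [h₁] at h₃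
        rw [hd.1]
        simpa [mul_assoc] using h₃
  refine LinearMap.ext fun p => ?_
  induction p using word_induction e with
  | word l => exact key l
  | zero => simp
  | add a b ha hb => rw [map_add, map_add, ha, hb]
  | smul z a ha => rw [map_smul, map_smul, ha]

end NormalOrdering

open FormalDeformation

/-! ### Reflections and coefficients under conjugation. -/

section Coefficients

variable {G V : Type*} [Group G] [AddCommGroup V] [Module ℂ V]
  [DistribMulAction G V] [SMulCommClass G ℂ V]

theorem one_notMem_reflections : (1 : G) ∉ reflections G V := by
  have : (1 : V →ₗ[ℂ] V) - act V (1 : G) = 0 := by ext v; simp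
  change ¬ Module.finrank ℂ (LinearMap.range (1 - act V (1 : G))) = 2
  rw [this, LinearMap.range_zero, finrank_bot]
  norm_num

/-- The action of g carries Im(1 - s) isomorphically onto Im(1 - g s g⁻¹). -/
theorem conj_mem_reflections_iff (g s : G) :
    g * s * g⁻¹ ∈ reflections G V ↔ s ∈ reflections G V := by
  have key : ∀ g s : G, s ∈ reflections G V → g * s * g⁻¹ ∈ reflections G V := by
    intro g s hs
    have h : LinearMap.range (1 - act V (g * s * g⁻¹)) =
        (LinearMap.range (1 - act V s)).map
          (DistribMulAction.toLinearEquiv ℂ V g : V →ₗ[ℂ] V) := by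
      rw [← LinearMap.range_comp]
      have : (1 - act V (g * s * g⁻¹)) ∘ₗ (DistribMulAction.toLinearEquiv ℂ V g : V →ₗ[ℂ] V) =
          (DistribMulAction.toLinearEquiv ℂ V g : V →ₗ[ℂ] V) ∘ₗ (1 - act V s) := by
        ext v
        simp [smul_smul, smul_sub]
      rw [← this, LinearMap.range_comp_of_range_eq_top]
      exact LinearEquiv.range _
    change Module.finrank ℂ _ = 2
    rw [h, LinearEquiv.finrank_map_eq]
    exact hs
  refine ⟨fun h => ?_, key g s⟩
  have := key g⁻¹ _ h
  simpa [mul_assoc] using this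

variable {ℓ : ℕ} (b : Module.Basis (Fin ℓ) ℂ (invariantFunctions G V))

open Classical in
/-- The coefficient attached to `s`: `1` for `s = 1`, `-2 c_s` for a reflection, and zero
otherwise. -/
def curvCoef (s : G) : FormalRing ℂ ℓ :=
  if s = 1 then 1
  else if h : s ∈ reflections G V then -2 * formalParam b ⟨s, h⟩
  else 0

theorem curvCoef_one : curvCoef b 1 = 1 := if_pos rfl

theorem curvCoef_reflection (s : reflections G V) :
    curvCoef b s = -2 * formalParam b s := by
  have h1 : (s : G) ≠ 1 := fun h => one_notMem_reflections (G := G) (V := V) (h ▸ s.2)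
  rw [curvCoef, if_neg h1, dif_pos s.2]

theorem curvCoef_eq_zero {s : G} (h1 : s ≠ 1) (h : s ∉ reflections G V) : curvCoef b s = 0 := by
  rw [curvCoef, if_neg h1, dif_neg h]

/-- The formal parameter is linear in the variables, so only the Weyl term at s = 1 survives modulo
𝔪. -/
theorem constantCoeff_curvCoef {s : G} (h1 : s ≠ 1) :
    MvPowerSeries.constantCoeff (curvCoef b s) = 0 := by
  by_cases h : s ∈ reflections G V
  · rw [curvCoef_reflection b ⟨s, h⟩]
    simp [formalParam, MvPowerSeries.constantCoeff_smul]
  · simp [curvCoef_eq_zero b h1 h]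

theorem curvCoef_conj (g s : G) : curvCoef b (g * s * g⁻¹) = curvCoef b s := by
  have h1 : g * s * g⁻¹ = 1 ↔ s = 1 := by simp
  by_cases hs1 : s = 1
  · simp [hs1]
  by_cases hs : s ∈ reflections G V
  · have hs' := (conj_mem_reflections_iff (V := V) g s).mpr hs
    rw [curvCoef_reflection b ⟨s, hs⟩, curvCoef_reflection b ⟨_, hs'⟩, formalParam, formalParam]
    congr 1
    refine Finset.sum_congr rfl fun i _ => ?_
    rw [(b i).2 g ⟨s, hs⟩ ⟨_, hs'⟩ rfl]
  · rw [curvCoef_eq_zero b hs1 hs, curvCoef_eq_zero b (mt h1.mp hs1)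
      (mt (conj_mem_reflections_iff g s).mp hs)]

end Coefficients

/-! ### The forms attached to group elements and their Jacobi identity. -/

section Curvature

variable {G V : Type*} [Group G] [Finite G] [AddCommGroup V] [Module ℂ V] [FiniteDimensional ℂ V]
  [DistribMulAction G V] [SMulCommClass G ℂ V]

/-- The projection to the image of `1 - s` along its kernel. -/
abbrev reflProj (V : Type*) [AddCommGroup V] [Module ℂ V] [FiniteDimensional ℂ V]
    [DistribMulAction G V] [SMulCommClass G ℂ V] (s : G) : V →ₗ[ℂ] V :=
  Submodule.projection _ _ (isCompl_range_ker V s)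

theorem reflProj_mem (s : G) (x : V) : reflProj V s x ∈ LinearMap.range (1 - act V s) :=
  Submodule.projection_apply_mem _ x

theorem smul_sub_reflProj (s : G) (x : V) : s • (x - reflProj V s x) = x - reflProj V s x := by
  have h : x - reflProj V s x ∈ LinearMap.ker (1 - act V s) := by
    rw [← Submodule.ker_projection (isCompl_range_ker V s), LinearMap.mem_ker, map_sub,
      Submodule.projection_apply_of_mem_left _ (reflProj_mem s x), sub_self]
  have h' : (x - reflProj V s x) - s • (x - reflProj V s x) = 0 := h
  exact (sub_eq_zero.mp h').symm

theorem reflProj_eq_of (s : G) {x u : V} (hu : u ∈ LinearMap.range (1 - act V s))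
    (hx : s • (x - u) = x - u) : reflProj V s x = u := by
  have h : x - u ∈ LinearMap.ker (1 - act V s) := by
    change (x - u) - s • (x - u) = 0
    rw [hx, sub_self]
  have h₁ : reflProj V s (x - u) = 0 := by
    rwa [← LinearMap.mem_ker, Submodule.ker_projection]
  rw [map_sub, sub_eq_zero] at h₁
  rw [h₁]
  exact Submodule.projection_apply_left (isCompl_range_ker V s) ⟨u, hu⟩

/-- g carries the image and the kernel of 1 - s to those of 1 - g s g⁻¹, hence intertwines the two
projections. -/
theorem reflProj_conj (g s : G) (x : V) :
    reflProj V (g * s * g⁻¹) (g • x) = g • reflProj V s x := by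
  refine reflProj_eq_of _ ?_ ?_
  · obtain ⟨v, hv⟩ := reflProj_mem s x
    refine ⟨g • v, ?_⟩
    rw [← hv]
    change g • v - (g * s * g⁻¹) • g • v = g • (v - s • v)
    rw [smul_smul, inv_mul_cancel_right, mul_smul, smul_sub]
  · rw [← smul_sub, smul_smul, inv_mul_cancel_right, mul_smul, smul_sub_reflProj]

variable (ω : LinearMap.BilinForm ℂ V)

open Classical in
/-- The form attached to `s`: `ω` for `s = 1`, `ω_s` for a reflection, and zero otherwise. -/
def curvForm (s : G) : LinearMap.BilinForm ℂ V :=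
  if s = 1 then ω
  else if s ∈ reflections G V then ω.compl₁₂ (reflProj V s) (reflProj V s)
  else 0

theorem curvForm_one : curvForm ω (1 : G) = ω := if_pos rfl

theorem curvForm_reflection {s : G} (hs : s ∈ reflections G V) (x y : V) :
    curvForm ω s x y = reflForm ω s x y := by
  have h1 : s ≠ 1 := fun h => one_notMem_reflections (G := G) (V := V) (h ▸ hs)
  rw [curvForm, if_neg h1, if_pos hs]
  rfl

theorem curvForm_conj [PreservesForm G ω] (g s : G) (x y : V) :
    curvForm ω (g * s * g⁻¹) (g • x) (g • y) = curvForm ω s x y := by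
  have h1 : g * s * g⁻¹ = 1 ↔ s = 1 := by simp
  by_cases hs1 : s = 1
  · rw [h1.mpr hs1, hs1, curvForm_one]
    exact PreservesForm.apply_smul_smul g x y
  by_cases hs : s ∈ reflections G V
  · rw [curvForm_reflection ω hs, curvForm_reflection ω ((conj_mem_reflections_iff g s).mpr hs)]
    have h := PreservesForm.apply_smul_smul (ω := ω) g (reflProj V s x) (reflProj V s y)
    rw [← reflProj_conj, ← reflProj_conj] at h
    exact h
  · rw [curvForm, curvForm, if_neg hs1, if_neg (mt h1.mp hs1), if_neg hs,
      if_neg (mt (conj_mem_reflections_iff g s).mp hs)]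
    rfl

theorem curvForm_alt (hω : ω.IsAlt) (s : G) (x : V) : curvForm ω s x x = 0 := by
  unfold curvForm
  split_ifs
  · exact hω x
  · exact hω _
  · rfl

/-- An alternating trilinear expression in a two-dimensional space vanishes. -/
theorem jacobi_of_finrank_two (hω : ω.IsAlt) {R : Submodule ℂ V} (hR : Module.finrank ℂ R = 2)
    (L : V →ₗ[ℂ] V) {x y z : V} (hx : x ∈ R) (hy : y ∈ R) (hz : z ∈ R) :
    ω x y • L z + ω y z • L x + ω z x • L y = 0 := by
  have : FiniteDimensional ℂ R := Module.finite_of_finrank_pos (by omega)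
  let e := Module.finBasisOfFinrankEq ℂ R hR
  have coords : ∀ v ∈ R, ∃ a b : ℂ, v = a • (e 0 : V) + b • (e 1 : V) := by
    intro v hv
    refine ⟨e.repr ⟨v, hv⟩ 0, e.repr ⟨v, hv⟩ 1, ?_⟩
    have h := e.sum_repr ⟨v, hv⟩
    rw [Fin.sum_univ_two] at h
    exact (congrArg Subtype.val h).symm
  obtain ⟨a, b, rfl⟩ := coords x hx
  obtain ⟨a', b', rfl⟩ := coords y hy
  obtain ⟨a'', b'', rfl⟩ := coords z hz
  have h0 := hω (e 0 : V)
  have h1 := hω (e 1 : V)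
  have h10 : ω (e 1 : V) (e 0 : V) = - ω (e 0 : V) (e 1 : V) := (hω.neg_eq _ _).symm
  simp only [map_add, map_smul, LinearMap.add_apply, LinearMap.smul_apply, smul_eq_mul, h0, h1,
    h10]
  module

/-- For s = 1 every s • v - v is zero. For a reflection, ω_s and s - 1 factor through the projection
to Im(1 - s), so all three vectors may be taken in a plane. This is where rank 2 enters. -/
theorem curvForm_jacobi (hω : ω.IsAlt) (s : G) (x y z : V) :
    curvForm ω s x y • (s • z - z) + curvForm ω s y z • (s • x - x) +
      curvForm ω s z x • (s • y - y) = 0 := by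
  unfold curvForm
  split_ifs with h1 hs
  · simp [h1]
  · have hP : ∀ v : V, s • v - v = (act V s - 1) (reflProj V s v) := by
      intro v
      have h := smul_sub_reflProj s v
      change s • v - v = s • reflProj V s v - reflProj V s v
      rw [smul_sub] at h
      rw [sub_eq_sub_iff_add_eq_add] at h ⊢
      rw [h]
      abel
    simp only [hP, LinearMap.compl₁₂_apply]
    exact jacobi_of_finrank_two ω hω hs _ (reflProj_mem s x) (reflProj_mem s y) (reflProj_mem s z)
  · simp

variable {ℓ : ℕ} (b : Module.Basis (Fin ℓ) ℂ (invariantFunctions G V))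

/-- The commutation relations of `H_c(V, G)`, with coefficients acting on the formal power series
over a `ℂ`-algebra `A` that contains `G`. -/
def curvData {A : Type*} [Ring A] [Algebra ℂ A] (j : G →* A) (hω : ω.IsAlt)
    [PreservesForm G ω] : CurvatureData G V (MvPowerSeries (Fin ℓ) A) where
  form := curvForm ω
  coef s := LinearMap.mulLeft ℂ (algebraMap (FormalRing ℂ ℓ) _ (curvCoef b s))
  ract g := LinearMap.mulRight ℂ (MvPowerSeries.C (j g))
  form_alt := curvForm_alt ω hω
  form_conj := curvForm_conj ω
  jacobi := curvForm_jacobi ω hω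
  coef_conj g s := by rw [curvCoef_conj]
  coef_comm s r n := by
    simp only [LinearMap.mulLeft_apply, ← mul_assoc, ← map_mul, mul_comm]
  coef_ract s r n := by simp [mul_assoc]
  ract_mul g h n := by simp [mul_assoc]

theorem neg_two_mul_mul {R : Type*} [Ring R] (r r' : R) : -(2 * (r * r')) = -2 * r * r' := by
  noncomm_ring

/-- Rewriting the right-hand side as one sum over G, with ω as the term at 1 and zero outside S ∪
{1}, puts it in the shape of `CurvatureData`. -/
theorem kappa_eq_sum [Fintype G] (x y : V) :
    kappa ω 1 (formalParam b) x y =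
      ∑ s : G, algebraMap (FormalRing ℂ ℓ) (MvPowerSeries (Fin ℓ) (SmashTensor G V))
        (curvCoef b s) * (curvForm ω s x y • grp V ℓ s) := by
  classical
  rw [← Finset.add_sum_erase _ _ (Finset.mem_univ (1 : G)), kappa, sub_eq_add_neg]
  refine congrArg₂ (· + ·) ?_ ?_
  · rw [curvCoef_one, curvForm_one, map_one, one_mul, one_smul, Algebra.algebraMap_eq_smul_one]
    rfl
  · rw [Finset.mul_sum, ← Finset.sum_neg_distrib]
    have : ∀ s : reflections G V, -(2 * formalParam b s • reflForm ω (s : G) x y • grp V ℓ (s : G)) =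
        algebraMap (FormalRing ℂ ℓ) (MvPowerSeries (Fin ℓ) (SmashTensor G V))
          (curvCoef b s) * (curvForm ω (s : G) x y • grp V ℓ (s : G)) := by
      intro s
      rw [curvCoef_reflection, curvForm_reflection ω s.2, Algebra.smul_def, map_mul, map_neg,
        map_ofNat]
      exact neg_two_mul_mul _ _
    rw [Finset.sum_congr rfl fun s _ => this s]
    rw [Finset.sum_set_coe (reflections G V) (f := fun s : G =>
      algebraMap (FormalRing ℂ ℓ) (MvPowerSeries (Fin ℓ) (SmashTensor G V))
          (curvCoef b s) * (curvForm ω s x y • grp V ℓ s))]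
    refine Finset.sum_subset ?_ ?_
    · intro s hs
      rw [Set.mem_toFinset] at hs
      simp only [Finset.mem_erase, Finset.mem_univ, and_true]
      exact fun h => one_notMem_reflections (G := G) (V := V) (h ▸ hs)
    · intro s hs hs'
      rw [Set.mem_toFinset] at hs'
      rw [curvCoef_eq_zero b (Finset.ne_of_mem_erase hs) hs', map_zero, zero_mul]

end Curvature

/-! ### Extension from T(V) to G ⋉ T(V). -/

section SmashExtension

open TensorAlgebra

variable {G V N : Type*} [Group G] [AddCommGroup V] [Module ℂ V]
  [DistribMulAction G V] [SMulCommClass G ℂ V] [AddCommGroup N] [Module ℂ N]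

namespace CurvatureData

variable [Fintype G] (D : CurvatureData G V N)

/-- The extension of a linear map from `T(V)` to `G ⋉ T(V)` that is compatible with the right
action of `G`. -/
def smashExtend (f : TensorAlgebra ℂ V →ₗ[ℂ] N) : SmashTensor G V →ₗ[ℂ] N where
  toFun z := ∑ g, D.ract g (f (z.coeff g))
  map_add' z z' := by simp [Finset.sum_add_distrib]
  map_smul' c z := by simp [Finset.smul_sum]

theorem smashExtend_single (f : TensorAlgebra ℂ V →ₗ[ℂ] N) (g : G) (a : TensorAlgebra ℂ V) :
    D.smashExtend f (SkewMonoidAlgebra.single g a) = D.ract g (f a) := by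
  classical
  change ∑ h, D.ract h (f ((SkewMonoidAlgebra.single g a).coeff h)) = _
  rw [Finset.sum_eq_single g]
  · simp
  · intro h _ hne
    simp [Finsupp.single_eq_of_ne hne]
  · simp

theorem smashExtend_commutator {f : TensorAlgebra ℂ V →ₗ[ℂ] N}
    (hf : ∀ p x y q, D.Holds f p x y q) (p q : SmashTensor G V) (x y : V) :
    D.smashExtend f (p * SkewMonoidAlgebra.single 1 (ι ℂ x * ι ℂ y - ι ℂ y * ι ℂ x) * q) =
      ∑ s, D.coef s (D.form s x y • D.smashExtend f (p * SkewMonoidAlgebra.single s 1 * q)) := by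
  induction p using SkewMonoidAlgebra.induction_on with
  | zero => simp
  | add p p' hp hp' => simp only [add_mul, map_add, hp, hp', smul_add, Finset.sum_add_distrib]
  | single g a =>
    induction q using SkewMonoidAlgebra.induction_on with
    | zero => simp
    | add q q' hq hq' => simp only [mul_add, map_add, hq, hq', smul_add, Finset.sum_add_distrib]
    | single h c =>
      -- Moving g from the left factor to the far right twists x, y and c by g; reindexing the sum
      -- by conjugation removes the twist from the forms and coefficients.
      have key := hf a (g • x) (g • y) (g • c)
      rw [Holds, curv, ← (MulAut.conj g).toEquiv.sum_comp] at key
      simp only [MulEquiv.toEquiv_eq_coe, EquivLike.coe_coe, MulAut.conj_apply, D.form_conj,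
        D.coef_conj, smul_smul, inv_mul_cancel_right] at key
      simp only [SkewMonoidAlgebra.single_mul_single, smashExtend_single, mul_one, smul_mul',
        smul_sub, smul_ι, smul_one, key, map_sum]
      refine Finset.sum_congr rfl fun s _ => ?_
      rw [D.coef_ract, ← D.ract_mul, map_smul, mul_assoc g s h,
        show g * s * g⁻¹ * (g * h) = g * (s * h) by group]

end CurvatureData

end SmashExtension

end SymplecticReflection

namespace FormalDeformation

open Finset.HasAntidiagonal

/-! ### Continuous extension to formal power series. -/

section SeriesExtend

variable {ℓ : ℕ} {F A : Type*} [Ring F] [Ring A]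

/-- The continuous extension of an additive map `F → A[[ħ₁, …, ħ_ℓ]]` to `F[[ħ₁, …, ħ_ℓ]]`. -/
def seriesExtend (θ : F →+ MvPowerSeries (Fin ℓ) A) :
    MvPowerSeries (Fin ℓ) F →+ MvPowerSeries (Fin ℓ) A where
  toFun x := fun n => ∑ p ∈ antidiagonal n,
    MvPowerSeries.coeff p.1 (θ (MvPowerSeries.coeff p.2 x))
  map_zero' := by
    funext n
    simp
    rfl
  map_add' x y := by
    funext n
    simp only [map_add, Finset.sum_add_distrib]
    rfl

variable (θ : F →+ MvPowerSeries (Fin ℓ) A)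

theorem coeff_seriesExtend (x : MvPowerSeries (Fin ℓ) F) (n : Fin ℓ →₀ ℕ) :
    MvPowerSeries.coeff n (seriesExtend θ x) =
      ∑ p ∈ antidiagonal n, MvPowerSeries.coeff p.1 (θ (MvPowerSeries.coeff p.2 x)) := rfl

theorem seriesExtend_C (z : F) : seriesExtend θ (MvPowerSeries.C z) = θ z := by
  classical
  ext n
  rw [coeff_seriesExtend, Finset.sum_eq_single (n, 0)]
  · simp
  · rintro ⟨i, j⟩ hij hne
    have hj : j ≠ 0 := by
      rintro rfl
      simp at hij
      exact hne (by simp [hij])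
    simp [MvPowerSeries.coeff_C, hj]
  · simp

/-- The variables pass through the extension, so a series factor may be expanded into its
coefficients. Vanishing on multiples then needs checking only for constant factors. -/
theorem coeff_seriesExtend_mul_left (y x : MvPowerSeries (Fin ℓ) F) (n : Fin ℓ →₀ ℕ) :
    MvPowerSeries.coeff n (seriesExtend θ (y * x)) = ∑ p ∈ antidiagonal n,
      MvPowerSeries.coeff p.2
        (seriesExtend θ (MvPowerSeries.C (MvPowerSeries.coeff p.1 y) * x)) := by
  classical
  simp only [coeff_seriesExtend, MvPowerSeries.coeff_C_mul]
  simp only [MvPowerSeries.coeff_mul, map_sum]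
  rw [Finset.sum_sigma', Finset.sum_sigma']
  refine Finset.sum_nbij' (fun ⟨⟨a, _⟩, ⟨i, j⟩⟩ => ⟨(i, a + j), (a, j)⟩)
    (fun ⟨⟨i, _⟩, ⟨a, j⟩⟩ => ⟨(a, i + j), (i, j)⟩) ?_ ?_ ?_ ?_ ?_
  all_goals
    rintro ⟨⟨a, b⟩, ⟨c, d⟩⟩ h
    simp only [Finset.mem_sigma, mem_antidiagonal] at h ⊢
  · exact ⟨by rw [← h.1, ← h.2]; abel, trivial⟩
  · exact ⟨by rw [← h.1, ← h.2]; abel, trivial⟩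
  · simp [h.2]
  · simp [h.2]

theorem coeff_seriesExtend_mul_right (x y : MvPowerSeries (Fin ℓ) F) (n : Fin ℓ →₀ ℕ) :
    MvPowerSeries.coeff n (seriesExtend θ (x * y)) = ∑ p ∈ antidiagonal n,
      MvPowerSeries.coeff p.2
        (seriesExtend θ (x * MvPowerSeries.C (MvPowerSeries.coeff p.1 y))) := by
  classical
  simp only [coeff_seriesExtend, MvPowerSeries.coeff_mul_C]
  simp only [MvPowerSeries.coeff_mul, map_sum]
  rw [Finset.sum_sigma', Finset.sum_sigma']
  refine Finset.sum_nbij' (fun ⟨⟨a, _⟩, ⟨i, j⟩⟩ => ⟨(j, a + i), (a, i)⟩)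
    (fun ⟨⟨j, _⟩, ⟨a, i⟩⟩ => ⟨(a, i + j), (i, j)⟩) ?_ ?_ ?_ ?_ ?_
  all_goals
    rintro ⟨⟨a, b⟩, ⟨c, d⟩⟩ h
    simp only [Finset.mem_sigma, mem_antidiagonal] at h ⊢
  · exact ⟨by rw [← h.1, ← h.2]; abel, trivial⟩
  · exact ⟨by rw [← h.1, ← h.2]; abel, trivial⟩
  · simp [h.2]
  · simp [h.2]

theorem degree_le_of_mem_antidiagonal {n : Fin ℓ →₀ ℕ} {p : (Fin ℓ →₀ ℕ) × (Fin ℓ →₀ ℕ)}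
    (h : p ∈ antidiagonal n) : p.1.degree + p.2.degree = n.degree := by
  rw [← mem_antidiagonal.mp h, map_add]

/-- A continuous extension that vanishes on all two-sided constant multiples of the relations
vanishes on the closed ideal generated by them. -/
theorem seriesExtend_eq_zero_of_mem_closedIdeal {rels : Set (MvPowerSeries (Fin ℓ) F)}
    (h : ∀ r ∈ rels, ∀ p q : F,
      seriesExtend θ (MvPowerSeries.C p * r * MvPowerSeries.C q) = 0)
    {z : MvPowerSeries (Fin ℓ) F} (hz : z ∈ closedIdeal rels) : seriesExtend θ z = 0 := by
  -- The kernel itself need not be an ideal. The elements whose two-sided constant multiples are all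
  -- killed form one, and it is adically closed.
  let J : TwoSidedIdeal (MvPowerSeries (Fin ℓ) F) := TwoSidedIdeal.mk'
    {z | ∀ p q : F, seriesExtend θ (MvPowerSeries.C p * z * MvPowerSeries.C q) = 0}
    (by simp)
    (fun {x y} hx hy p q => by
      rw [mul_add, add_mul, map_add, hx p q, hy p q, add_zero])
    (fun {x} hx p q => by rw [mul_neg, neg_mul, map_neg, hx p q, neg_zero])
    (fun {x y} hy p q => by
      ext n
      rw [← mul_assoc, mul_assoc, coeff_seriesExtend_mul_left]
      refine Finset.sum_eq_zero fun i _ => ?_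
      rw [MvPowerSeries.coeff_C_mul, ← mul_assoc, hy, map_zero])
    (fun {x y} hx p q => by
      ext n
      rw [← mul_assoc, mul_assoc, coeff_seriesExtend_mul_right]
      refine Finset.sum_eq_zero fun i _ => ?_
      rw [MvPowerSeries.coeff_mul_C, hx, map_zero])
  have hJ : ∀ z, z ∈ J ↔ ∀ p q : F,
      seriesExtend θ (MvPowerSeries.C p * z * MvPowerSeries.C q) = 0 := fun z =>
    TwoSidedIdeal.mem_mk' _ _ _ _ _ _ z
  have hmem : z ∈ J := by
    refine (TwoSidedIdeal.mem_sInf _).mp hz J ?_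
    refine ⟨fun r hr => (hJ r).mpr (h r hr), fun x hx => (hJ x).mpr fun p q => ?_⟩
    ext n
    -- The coefficient at n of the extension reads only coefficients of degree at most that of n, so
    -- approximation one order beyond suffices.
    obtain ⟨y, hy, hxy⟩ := hx (n.degree + 1)
    rw [← (hJ y).mp hy p q, coeff_seriesExtend, coeff_seriesExtend]
    refine Finset.sum_congr rfl fun i hi => ?_
    have := degree_le_of_mem_antidiagonal hi
    simp only [MvPowerSeries.coeff_C_mul, MvPowerSeries.coeff_mul_C]
    rw [hxy _ (by omega)]
  simpa using (hJ z).mp hmem 1 1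

theorem isAdicallyClosed_closedIdeal (rels : Set (MvPowerSeries (Fin ℓ) F)) :
    IsAdicallyClosed (closedIdeal rels) := by
  intro x hx
  refine (TwoSidedIdeal.mem_sInf _).mpr ?_
  rintro J ⟨hJ, hcl⟩
  refine hcl x fun N => ?_
  obtain ⟨y, hy, h⟩ := hx N
  exact ⟨y, (TwoSidedIdeal.mem_sInf _).mp hy J ⟨hJ, hcl⟩, h⟩

theorem subset_closedIdeal (rels : Set (MvPowerSeries (Fin ℓ) F)) :
    rels ⊆ (closedIdeal rels : Set (MvPowerSeries (Fin ℓ) F)) := fun _ hr =>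
  (TwoSidedIdeal.mem_sInf _).mpr fun _ hJ => hJ.1 hr

section Triangular

variable {θ} {π : F →+ A}

/-- Triangularity: beyond π of the coefficient at n, only coefficients at strictly smaller exponents
contribute. -/
theorem coeff_seriesExtend_eq_add (hθ : ∀ z, MvPowerSeries.coeff 0 (θ z) = π z)
    (x : MvPowerSeries (Fin ℓ) F) (n : Fin ℓ →₀ ℕ) :
    MvPowerSeries.coeff n (seriesExtend θ x) = π (MvPowerSeries.coeff n x) +
      ∑ p ∈ (antidiagonal n).erase (0, n),
        MvPowerSeries.coeff p.1 (θ (MvPowerSeries.coeff p.2 x)) := by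
  rw [coeff_seriesExtend, ← Finset.add_sum_erase _ _ (a := (0, n)) (by simp), hθ]

/-- The triangular system is solved for the coefficients by recursion on exponents, with a
set-theoretic section of π at each one. -/
theorem seriesExtend_surjective (hθ : ∀ z, MvPowerSeries.coeff 0 (θ z) = π z)
    (hπ : Function.Surjective π) : Function.Surjective (seriesExtend θ) := by
  classical
  intro y
  choose σ hσ using hπ
  let x : MvPowerSeries (Fin ℓ) F := (wellFounded_lt (α := Fin ℓ →₀ ℕ)).fix fun n ih =>
    σ (MvPowerSeries.coeff n y - ∑ p ∈ ((antidiagonal n).erase (0, n)).attach,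
      MvPowerSeries.coeff p.1.1 (θ (if h : p.1.2 < n then ih p.1.2 h else 0)))
  have hx : ∀ n, MvPowerSeries.coeff n x =
      σ (MvPowerSeries.coeff n y - ∑ p ∈ (antidiagonal n).erase (0, n),
        MvPowerSeries.coeff p.1 (θ (MvPowerSeries.coeff p.2 x))) := by
    intro n
    change x n = _
    rw [show x n = _ from WellFounded.fix_eq _ _ _]
    refine congrArg (fun t => σ (MvPowerSeries.coeff n y - t)) ?_
    rw [← Finset.sum_attach ((antidiagonal n).erase (0, n))]
    refine Finset.sum_congr rfl fun p _ => ?_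
    obtain ⟨⟨i, j⟩, hp⟩ := p
    have hlt : j < n := by
      rw [Finset.mem_erase, mem_antidiagonal] at hp
      refine lt_of_le_of_ne ?_ ?_
      · rw [← hp.2]; exact le_add_self
      · rintro rfl
        exact hp.1 (by simpa using hp.2)
    rw [dif_pos hlt]
    rfl
  refine ⟨x, ?_⟩
  ext n
  rw [coeff_seriesExtend_eq_add hθ, hx, hσ, sub_add_cancel]

/-- The kernel of a continuous extension is contained in a closed ideal `J` that the extension
kills, if the leading term of the extension has the constant terms of `J` as kernel. -/
theorem mem_of_seriesExtend_eq_zero (hθ : ∀ z, MvPowerSeries.coeff 0 (θ z) = π z)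
    {J : TwoSidedIdeal (MvPowerSeries (Fin ℓ) F)} (hcl : IsAdicallyClosed J)
    (hJ : ∀ z ∈ J, seriesExtend θ z = 0)
    (hlift : ∀ z, π z = 0 → ∃ y ∈ J, MvPowerSeries.coeff 0 y = z)
    {x : MvPowerSeries (Fin ℓ) F} (hx : seriesExtend θ x = 0) : x ∈ J := by
  classical
  refine hcl x fun N => ?_
  induction N with
  | zero => exact ⟨0, J.zero_mem, by simp⟩
  | succ N ih =>
    obtain ⟨y, hy, hxy⟩ := ih
    -- The extension kills x - y, whose terms below degree N vanish, so triangularity leaves only π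
    -- of its coefficients in degree N.
    have hker : ∀ n : Fin ℓ →₀ ℕ, n.degree = N → π (MvPowerSeries.coeff n (x - y)) = 0 := by
      intro n hn
      have h := coeff_seriesExtend_eq_add hθ (x - y) n
      rw [map_sub, hx, hJ y hy, sub_zero, map_zero, Finset.sum_eq_zero, add_zero] at h
      · exact h.symm
      · rintro ⟨i, j⟩ hij
        rw [Finset.mem_erase] at hij
        have hdeg := degree_le_of_mem_antidiagonal hij.2
        have hi : i.degree ≠ 0 := by
          rw [Ne, Finsupp.degree_eq_zero_iff]
          rintro rfl
          have := mem_antidiagonal.mp hij.2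
          exact hij.1 (by simpa using this)
        rw [map_sub, hxy j (by simp only at hdeg; omega), sub_self, map_zero, map_zero]
    have hex : ∀ n : Fin ℓ →₀ ℕ, ∃ z ∈ J,
        n.degree = N → MvPowerSeries.coeff 0 z = MvPowerSeries.coeff n (x - y) := by
      intro n
      by_cases hn : n.degree = N
      · obtain ⟨z, hz, h⟩ := hlift _ (hker n hn)
        exact ⟨z, hz, fun _ => h⟩
      · exact ⟨0, J.zero_mem, fun h => absurd h hn⟩
    choose z hz hzc using hex
    -- Adding ħ^n z_n for every n of degree N repairs exactly those coefficients and changes nothing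
    -- of lower degree.
    refine ⟨y + ∑ n ∈ Finset.finsuppAntidiag Finset.univ N, MvPowerSeries.monomial n 1 * z n,
      J.add_mem hy (sum_mem fun n _ => J.mul_mem_left _ _ (hz n)), fun m hm => ?_⟩
    have hS : ∀ n : Fin ℓ →₀ ℕ, n ∈ Finset.finsuppAntidiag Finset.univ N ↔ n.degree = N := by
      intro n
      simp [Finset.mem_finsuppAntidiag, Finsupp.degree_eq_sum]
    simp only [map_add, map_sum, MvPowerSeries.coeff_monomial_mul, one_mul]
    rw [← sub_eq_iff_eq_add', ← map_sub]
    have hle : ∀ n : Fin ℓ →₀ ℕ, n.degree = N → n ≤ m → n = m := by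
      intro n hn hnm
      obtain ⟨k, rfl⟩ := exists_add_of_le hnm
      rw [map_add] at hm
      have hk : k.degree = 0 := by omega
      rw [Finsupp.degree_eq_zero_iff] at hk
      simp [hk]
    rcases Nat.lt_succ_iff_lt_or_eq.mp hm with hlt | heq
    · rw [map_sub, hxy m hlt, sub_self, Finset.sum_eq_zero]
      intro n hn
      rw [if_neg]
      intro hnm
      have h₁ := (hS n).mp hn
      rw [hle n h₁ hnm] at h₁
      omega
    · rw [Finset.sum_eq_single m]
      · rw [if_pos le_rfl, tsub_self, hzc m heq]
      · intro n hn hne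
        rw [if_neg]
        exact fun hnm => hne (hle n ((hS n).mp hn) hnm)
      · exact fun h => absurd ((hS m).mpr heq) h

end Triangular

end SeriesExtend

/-! ### Linearity over K and series without constant term. -/

section Algebras

variable {ℓ : ℕ} {F A : Type*} [Ring F] [Algebra ℂ F] [Ring A] [Algebra ℂ A]

theorem coeff_algebraMap (k : FormalRing ℂ ℓ) (n : Fin ℓ →₀ ℕ) :
    MvPowerSeries.coeff n (algebraMap (FormalRing ℂ ℓ) (MvPowerSeries (Fin ℓ) A) k) =
      algebraMap ℂ A (MvPowerSeries.coeff n k) :=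
  MvPowerSeries.coeff_map _ _ _

theorem coeff_algebraMap_mul (k : FormalRing ℂ ℓ) (x : MvPowerSeries (Fin ℓ) A)
    (n : Fin ℓ →₀ ℕ) :
    MvPowerSeries.coeff n (algebraMap (FormalRing ℂ ℓ) (MvPowerSeries (Fin ℓ) A) k * x) =
      ∑ p ∈ antidiagonal n, MvPowerSeries.coeff p.1 k • MvPowerSeries.coeff p.2 x := by
  classical
  rw [MvPowerSeries.coeff_mul]
  refine Finset.sum_congr rfl fun p _ => ?_
  rw [coeff_algebraMap, Algebra.smul_def]

theorem seriesExtend_algebraMap_mul (θ : F →ₗ[ℂ] MvPowerSeries (Fin ℓ) A) (k : FormalRing ℂ ℓ)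
    (x : MvPowerSeries (Fin ℓ) F) :
    seriesExtend θ.toAddMonoidHom (algebraMap (FormalRing ℂ ℓ) _ k * x) =
      algebraMap (FormalRing ℂ ℓ) _ k * seriesExtend θ.toAddMonoidHom x := by
  ext n
  rw [coeff_seriesExtend_mul_left, coeff_algebraMap_mul]
  refine Finset.sum_congr rfl fun p _ => ?_
  simp only [coeff_seriesExtend, coeff_algebraMap, MvPowerSeries.coeff_C_mul, Finset.smul_sum,
    ← Algebra.smul_def, LinearMap.toAddMonoidHom_coe, map_smul]
  rfl

/-- A series without constant term is a combination of the variables. -/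
theorem exists_eq_sum_mul_X {F : Type*} [Ring F] {x : MvPowerSeries (Fin ℓ) F} (hx : MvPowerSeries.coeff 0 x = 0) :
    ∃ y : Fin ℓ → MvPowerSeries (Fin ℓ) F, x = ∑ i, y i * MvPowerSeries.X i := by
  classical
  have hex : ∀ n : Fin ℓ →₀ ℕ, n ≠ 0 → ∃ i, n i ≠ 0 := fun n hn => by
    by_contra! h
    exact hn (Finsupp.ext h)
  -- Each nonconstant monomial is assigned to one variable dividing it; y_i collects those assigned
  -- to ħ_i.
  choose c hc using hex
  let y : Fin ℓ → MvPowerSeries (Fin ℓ) F := fun i m =>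
    if ∃ h : m + Finsupp.single i 1 ≠ 0, c _ h = i then
      MvPowerSeries.coeff (m + Finsupp.single i 1) x else 0
  have hy : ∀ i m, MvPowerSeries.coeff m (y i) =
    if ∃ h : m + Finsupp.single i 1 ≠ 0, c _ h = i then
      MvPowerSeries.coeff (m + Finsupp.single i 1) x else 0 := fun _ _ => rfl
  refine ⟨y, ?_⟩
  ext n
  have hterm : ∀ i, MvPowerSeries.coeff n (y i * MvPowerSeries.X i) =
      if ∃ h : n ≠ 0, c n h = i then MvPowerSeries.coeff n x else 0 := by
    intro i
    rw [MvPowerSeries.X_def, MvPowerSeries.coeff_mul_monomial, mul_one]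
    split_ifs with h₁ h₂ h₂
    · rw [hy, tsub_add_cancel_of_le h₁, if_pos h₂]
    · rw [hy, tsub_add_cancel_of_le h₁, if_neg h₂]
    · obtain ⟨hn, rfl⟩ := h₂
      refine absurd ?_ h₁
      rw [Finsupp.single_le_iff]
      exact Nat.one_le_iff_ne_zero.mpr (hc n hn)
    · rfl
  rw [map_sum, Finset.sum_congr rfl fun i _ => hterm i]
  by_cases hn : n = 0
  · subst hn
    simp [hx]
  · simp [hn]

end Algebras

end FormalDeformation

namespace SymplecticReflection

open FormalDeformation TensorAlgebra

/-! ### The projection onto G ⋉ Weyl(V) and its kernel. -/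

section Projection

variable {G V : Type*} [Group G] [AddCommGroup V] [Module ℂ V]
  [DistribMulAction G V] [SMulCommClass G ℂ V] (ω : LinearMap.BilinForm ℂ V) [PreservesForm G ω]

/-- The quotient map `G ⋉ T(V) → G ⋉ Weyl(V)`. -/
def smashProj : SmashTensor G V →+* SmashWeyl G ω :=
  SkewMonoidAlgebra.liftNCRingHom
    ((SkewMonoidAlgebra.singleOneRingHom).comp (Weyl.mk ω).toRingHom)
    (SkewMonoidAlgebra.of (Weyl ω) G) (by
      intro a g
      have h : g • Weyl.mk ω a = Weyl.mk ω (g • a) := weylMap_mk G ω g a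
      simp [SkewMonoidAlgebra.singleOneRingHom, SkewMonoidAlgebra.single_mul_single, h,
        -RingQuot.mkAlgHom_coe])

theorem smashProj_single (g : G) (a : TensorAlgebra ℂ V) :
    smashProj ω (SkewMonoidAlgebra.single g a) = SkewMonoidAlgebra.single g (Weyl.mk ω a) := by
  simp [smashProj, SkewMonoidAlgebra.liftNCRingHom, SkewMonoidAlgebra.singleOneRingHom,
    SkewMonoidAlgebra.single_mul_single, -RingQuot.mkAlgHom_coe]

theorem coeff_smashProj (z : SmashTensor G V) (g : G) :
    (smashProj ω z).coeff g = Weyl.mk ω (z.coeff g) := by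
  classical
  induction z using SkewMonoidAlgebra.induction_on with
  | zero => simp
  | add z z' h h' => simp [h, h']
  | single h a =>
    rw [smashProj_single]
    simp only [SkewMonoidAlgebra.coeff_single, Finsupp.single_apply]
    split_ifs <;> simp

theorem smashProj_surjective : Function.Surjective (smashProj ω : SmashTensor G V → _) := by
  intro z
  induction z using SkewMonoidAlgebra.induction_on with
  | zero => exact ⟨0, map_zero _⟩
  | add z z' h h' =>
    obtain ⟨y, rfl⟩ := h
    obtain ⟨y', rfl⟩ := h'
    exact ⟨y + y', map_add _ _ _⟩
  | single g a =>
    obtain ⟨a, rfl⟩ := RingQuot.mkAlgHom_surjective ℂ (WeylRel ω) a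
    exact ⟨SkewMonoidAlgebra.single g a, smashProj_single ω g a⟩

theorem weyl_mk_commutator (x y : V) :
    Weyl.mk ω (ι ℂ x * ι ℂ y - ι ℂ y * ι ℂ x) = algebraMap ℂ _ (ω x y) := by
  have h := RingQuot.mkAlgHom_rel ℂ (WeylRel.comm (ω := ω) x y)
  rwa [AlgHom.commutes] at h

/-- An element of the tensor algebra that vanishes in the Weyl algebra lies in every two-sided
ideal that contains the defining relations. -/
theorem mem_of_weyl_mk_eq_zero {V : Type*} [AddCommGroup V] [Module ℂ V]
    (ω : LinearMap.BilinForm ℂ V) (I : TwoSidedIdeal (TensorAlgebra ℂ V))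
    (hI : ∀ x y, ι ℂ x * ι ℂ y - ι ℂ y * ι ℂ x - algebraMap ℂ _ (ω x y) ∈ I)
    {a : TensorAlgebra ℂ V} (ha : Weyl.mk ω a = 0) : a ∈ I := by
  let F : RingQuot (WeylRel ω) →+* I.ringCon.Quotient := RingQuot.lift ⟨I.ringCon.mk', by
    rintro _ _ ⟨x, y⟩
    exact (RingCon.eq I.ringCon).mpr ((I.rel_iff _ _).mpr (hI x y))⟩
  have hF : I.ringCon.mk' a = F (Weyl.mk ω a) := by
    have h := RingQuot.lift_mkRingHom_apply (r := WeylRel ω) I.ringCon.mk' (by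
      rintro _ _ ⟨x, y⟩
      exact (RingCon.eq I.ringCon).mpr ((I.rel_iff _ _).mpr (hI x y))) a
    rw [← h, Weyl.mk, ← RingQuot.mkAlgHom_coe ℂ]
    rfl
  rw [ha, map_zero, ← map_zero I.ringCon.mk'] at hF
  exact (RingCon.eq I.ringCon).mp hF

end Projection

/-! ### The deformed projection and the relations of H_c(V, G). -/

section Relations

theorem single_sub {k G : Type*} [AddCommGroup k] (g : G) (a a' : k) :
    (SkewMonoidAlgebra.single g (a - a')) =
      SkewMonoidAlgebra.single g a - SkewMonoidAlgebra.single g a' := by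
  rw [sub_eq_add_neg, SkewMonoidAlgebra.single_add, SkewMonoidAlgebra.single_neg, ← sub_eq_add_neg]

theorem vec_commutator {G V : Type*} [Group G] [AddCommGroup V] [Module ℂ V]
    [DistribMulAction G V] [SMulCommClass G ℂ V] {ℓ : ℕ} (x y : V) :
    vec G ℓ x * vec G ℓ y - vec G ℓ y * vec G ℓ x =
      MvPowerSeries.C (SkewMonoidAlgebra.single 1 (ι ℂ x * ι ℂ y - ι ℂ y * ι ℂ x)) := by
  simp only [vec, ← map_mul, ← map_sub, SkewMonoidAlgebra.single_mul_single, one_smul, mul_one,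
    single_sub]

variable {G V : Type*} [Group G] [Finite G] [AddCommGroup V] [Module ℂ V] [FiniteDimensional ℂ V]
  [DistribMulAction G V] [SMulCommClass G ℂ V] (ω : LinearMap.BilinForm ℂ V)
  {ℓ : ℕ} (b : Module.Basis (Fin ℓ) ℂ (invariantFunctions G V))

/-- A homomorphism from `G ⋉ T(V)` that satisfies the relations of the Weyl algebra deforms to a
linear map that satisfies the commutation relations of `H_c(V, G)`. -/
theorem exists_deformedProj [Fintype G] [PreservesForm G ω] (hω : ω.IsAlt) {A : Type*} [Ring A] [Algebra ℂ A]
    (π : SmashTensor G V →ₐ[ℂ] A)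
    (hπ : ∀ x y, π (SkewMonoidAlgebra.single 1 (ι ℂ x * ι ℂ y - ι ℂ y * ι ℂ x)) =
      algebraMap ℂ A (ω x y)) :
    ∃ θ : SmashTensor G V →ₗ[ℂ] MvPowerSeries (Fin ℓ) A,
      (∀ z, MvPowerSeries.coeff 0 (θ z) = π z) ∧
      ∀ p q x y,
        θ (p * SkewMonoidAlgebra.single 1 (ι ℂ x * ι ℂ y - ι ℂ y * ι ℂ x) * q) =
          ∑ s, algebraMap (FormalRing ℂ ℓ) _ (curvCoef b s) *
            (curvForm ω s x y • θ (p * SkewMonoidAlgebra.single s 1 * q)) := by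
  classical
  let j : G →* A := (π : SmashTensor G V →* A).comp (SkewMonoidAlgebra.of (TensorAlgebra ℂ V) G)
  let D : CurvatureData G V (MvPowerSeries (Fin ℓ) A) := curvData ω b j hω
  let e := Module.finBasis ℂ V
  let emb : TensorAlgebra ℂ V →ₗ[ℂ] A :=
    π.toLinearMap ∘ₗ SkewMonoidAlgebra.lsingle (R := ℂ) (1 : G)
  have hemb : ∀ a, emb a = π (SkewMonoidAlgebra.single 1 a) := fun _ => rfl
  have hemb_mul : ∀ a a', emb (a * a') = emb a * emb a' := fun a a' => by
    rw [hemb, hemb, hemb, ← map_mul, SkewMonoidAlgebra.single_mul_single, one_smul, mul_one]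
  obtain ⟨f, hsorted, hf⟩ := D.exists_normalOrdering e fun w => MvPowerSeries.C (emb (word e w))
  let c₀ : MvPowerSeries (Fin ℓ) A →ₗ[ℂ] A :=
    { toFun := MvPowerSeries.coeff 0
      map_add' := map_add _
      map_smul' := fun _ _ => rfl }
  have hc₀ : ∀ n, c₀ n = MvPowerSeries.constantCoeff n := fun _ => rfl
  -- The constant term of f and the undeformed map both satisfy the Weyl relations and agree on
  -- words without descents, so they are equal. No independence of ordered monomials in `A` is used.
  have h0 : c₀ ∘ₗ f = emb := by
    refine eq_of_eq_on_sorted e ω _ _ ?_ ?_ ?_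
    · intro p x y q
      have h := hf p x y q
      rw [LinearMap.comp_apply, h, CurvatureData.curv, map_sum, Finset.sum_eq_single (1 : G)]
      · change c₀ (algebraMap (FormalRing ℂ ℓ) _ (curvCoef b 1) *
          (curvForm ω (1 : G) x y • f (p * (1 : G) • q) * MvPowerSeries.C (j 1))) = _
        rw [curvCoef_one, curvForm_one, map_one, one_mul, map_one, map_one, mul_one, one_smul,
          map_smul]
        rfl
      · intro s _ hs
        change c₀ (algebraMap (FormalRing ℂ ℓ) _ (curvCoef b s) * _) = 0
        rw [hc₀, map_mul, ← MvPowerSeries.coeff_zero_eq_constantCoeff_apply, coeff_algebraMap,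
          MvPowerSeries.coeff_zero_eq_constantCoeff_apply, constantCoeff_curvCoef b hs, map_zero,
          zero_mul]
      · simp
    · intro p x y q
      rw [hemb_mul, hemb_mul, hemb_mul, hemb (ι ℂ x * ι ℂ y - ι ℂ y * ι ℂ x), hπ,
        ← Algebra.commutes, mul_assoc, ← Algebra.smul_def]
    · intro w hw
      rw [LinearMap.comp_apply, hsorted w hw]
      exact MvPowerSeries.coeff_zero_C _
  refine ⟨D.smashExtend f, fun z => ?_, fun p q x y => D.smashExtend_commutator hf p q x y⟩
  induction z using SkewMonoidAlgebra.induction_on with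
  | zero => simp
  | add z z' h h' => rw [map_add, map_add, h, h', map_add]
  | single g a =>
    rw [D.smashExtend_single]
    change MvPowerSeries.coeff 0 (f a * MvPowerSeries.C (π (SkewMonoidAlgebra.of _ G g))) = _
    rw [MvPowerSeries.coeff_mul_C, show MvPowerSeries.coeff 0 (f a) = emb a from
      LinearMap.congr_fun h0 a, hemb, ← map_mul, SkewMonoidAlgebra.of_apply,
      SkewMonoidAlgebra.single_mul_single, one_smul, mul_one, one_mul]

/-- The continuous extension of the deformed projection kills the relations of `H_c(V, G)`. -/
theorem seriesExtend_relations [Fintype G] {A : Type*} [Ring A] [Algebra ℂ A]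
    {θ : SmashTensor G V →ₗ[ℂ] MvPowerSeries (Fin ℓ) A}
    (hθ : ∀ p q x y,
      θ (p * SkewMonoidAlgebra.single 1 (ι ℂ x * ι ℂ y - ι ℂ y * ι ℂ x) * q) =
        ∑ s, algebraMap (FormalRing ℂ ℓ) _ (curvCoef b s) *
          (curvForm ω s x y • θ (p * SkewMonoidAlgebra.single s 1 * q)))
    {r : MvPowerSeries (Fin ℓ) (SmashTensor G V)} (hr : r ∈ relations ω 1 (formalParam b))
    (p q : SmashTensor G V) :
    seriesExtend θ.toAddMonoidHom (MvPowerSeries.C p * r * MvPowerSeries.C q) = 0 := by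
  obtain ⟨⟨x, y⟩, rfl⟩ := hr
  simp only
  rw [vec_commutator, kappa_eq_sum, mul_sub, sub_mul, map_sub, ← map_mul, ← map_mul,
    seriesExtend_C, LinearMap.toAddMonoidHom_coe, hθ, sub_eq_zero, Finset.mul_sum,
    Finset.sum_mul, map_sum]
  refine Finset.sum_congr rfl fun s _ => ?_
  rw [← mul_assoc (MvPowerSeries.C p), ← Algebra.commutes, mul_assoc _ (MvPowerSeries.C p),
    mul_assoc _ (MvPowerSeries.C p * _), seriesExtend_algebraMap_mul]
  have h : MvPowerSeries.C p * (curvForm ω s x y • grp V ℓ s) * MvPowerSeries.C q =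
      MvPowerSeries.C (curvForm ω s x y • (p * SkewMonoidAlgebra.single s 1 * q)) := by
    have hC : ∀ (z : ℂ) (u : SmashTensor G V), (z • MvPowerSeries.C u :
        MvPowerSeries (Fin ℓ) (SmashTensor G V)) = MvPowerSeries.C (z • u) := by
      intro z u
      ext n : 1
      classical
      change z • MvPowerSeries.coeff n (MvPowerSeries.C u) = _
      rw [MvPowerSeries.coeff_C, MvPowerSeries.coeff_C]
      split_ifs <;> simp
    rw [grp, hC, ← map_mul, ← map_mul]
    simp [mul_assoc]
  rw [h, seriesExtend_C, LinearMap.toAddMonoidHom_coe, map_smul]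

/-- The elements that vanish in `G ⋉ Weyl(V)` are constant terms of relations of `H_c(V, G)`. -/
theorem exists_mem_closedIdeal_of_smashProj_eq_zero [PreservesForm G ω] {z : SmashTensor G V}
    (hz : smashProj ω z = 0) :
    ∃ y ∈ closedIdeal (relations ω 1 (formalParam b)), MvPowerSeries.coeff 0 y = z := by
  classical
  have := Fintype.ofFinite G
  set J := closedIdeal (relations ω 1 (formalParam b))
  -- The tensors that occur as constant terms of elements of J. This ideal contains the Weyl
  -- relations, hence the kernel of T(V) → Weyl(V).
  let I : TwoSidedIdeal (TensorAlgebra ℂ V) := TwoSidedIdeal.mk'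
    {a | ∃ y ∈ J, MvPowerSeries.constantCoeff y = SkewMonoidAlgebra.single (1 : G) a}
    ⟨0, J.zero_mem, by simp⟩
    (by
      rintro a a' ⟨y, hy, h⟩ ⟨y', hy', h'⟩
      exact ⟨y + y', J.add_mem hy hy', by rw [map_add, h, h', SkewMonoidAlgebra.single_add]⟩)
    (by
      rintro a ⟨y, hy, h⟩
      exact ⟨-y, J.neg_mem hy, by rw [map_neg, h, SkewMonoidAlgebra.single_neg]⟩)
    (by
      rintro a a' ⟨y, hy, h⟩
      refine ⟨MvPowerSeries.C (SkewMonoidAlgebra.single 1 a) * y, J.mul_mem_left _ _ hy, ?_⟩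
      rw [map_mul, h, MvPowerSeries.constantCoeff_C, SkewMonoidAlgebra.single_mul_single, one_smul,
        mul_one])
    (by
      rintro a a' ⟨y, hy, h⟩
      refine ⟨y * MvPowerSeries.C (SkewMonoidAlgebra.single 1 a'), J.mul_mem_right _ _ hy, ?_⟩
      rw [map_mul, h, MvPowerSeries.constantCoeff_C, SkewMonoidAlgebra.single_mul_single, one_smul,
        mul_one])
  have hI : ∀ a, a ∈ I ↔ ∃ y ∈ J, MvPowerSeries.constantCoeff y =
      SkewMonoidAlgebra.single (1 : G) a := fun a => TwoSidedIdeal.mem_mk' _ _ _ _ _ _ a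
  have hrel : ∀ x y, ι ℂ x * ι ℂ y - ι ℂ y * ι ℂ x - algebraMap ℂ _ (ω x y) ∈ I := by
    intro x y
    refine (hI _).mpr ⟨_, subset_closedIdeal _ ⟨(x, y), rfl⟩, ?_⟩
    simp only
    rw [vec_commutator, kappa_eq_sum, map_sub, MvPowerSeries.constantCoeff_C, map_sum,
      Finset.sum_eq_single (1 : G), single_sub 1 (_ - _)]
    · refine congrArg₂ (· - ·) rfl ?_
      rw [curvCoef_one, curvForm_one, map_one, one_mul]
      change ω x y • MvPowerSeries.constantCoeff (grp V ℓ (1 : G)) = _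
      rw [grp, MvPowerSeries.constantCoeff_C, SkewMonoidAlgebra.smul_single,
        Algebra.algebraMap_eq_smul_one]
    · intro s _ hs
      rw [map_mul, ← MvPowerSeries.coeff_zero_eq_constantCoeff_apply, coeff_algebraMap,
        MvPowerSeries.coeff_zero_eq_constantCoeff_apply, constantCoeff_curvCoef b hs, map_zero,
        zero_mul]
    · simp
  have hcoeff : ∀ g : G, ∃ y ∈ J, MvPowerSeries.constantCoeff y =
      SkewMonoidAlgebra.single (1 : G) (z.coeff g) := by
    intro g
    refine (hI _).mp (mem_of_weyl_mk_eq_zero ω I hrel ?_)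
    rw [← coeff_smashProj, hz]
    rfl
  choose y hy hyc using hcoeff
  -- Vanishing in G ⋉ Weyl(V) is tested coefficient by coefficient, so z = ∑ z_g g is reassembled
  -- from lifts of the z_g.
  refine ⟨∑ g, y g * MvPowerSeries.C (SkewMonoidAlgebra.single g 1),
    sum_mem fun g _ => J.mul_mem_right _ _ (hy g), ?_⟩
  rw [MvPowerSeries.coeff_zero_eq_constantCoeff_apply, map_sum]
  simp only [map_mul, hyc, MvPowerSeries.constantCoeff_C, SkewMonoidAlgebra.single_mul_single,
    one_mul, one_smul, mul_one]
  refine SkewMonoidAlgebra.ext fun g => ?_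
  have h := map_sum (SkewMonoidAlgebra.coeffAddEquiv (k := TensorAlgebra ℂ V) (G := G))
    (fun g => SkewMonoidAlgebra.single g (z.coeff g)) Finset.univ
  have h' := DFunLike.congr_fun h g
  rw [Finsupp.finsetSum_apply] at h'
  refine h'.trans ?_
  change ∑ i, (SkewMonoidAlgebra.single i (z.coeff i)).coeff g = _
  simp [Finsupp.single_apply]

end Relations

end SymplecticReflection

namespace FormalDeformation

/-! ### Passage to quotients. -/

section Quotients

variable {ℓ : ℕ} {F A : Type*} [Ring F] [Algebra ℂ F] [Ring A] [Algebra ℂ A]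

/-- The continuous extension of a linear map as a `K`-linear map to the module of formal series. -/
def seriesExtendLinear (θ : F →ₗ[ℂ] MvPowerSeries (Fin ℓ) A) :
    MvPowerSeries (Fin ℓ) F →ₗ[FormalRing ℂ ℓ] FormalSeries ℓ A where
  toFun x := seriesExtend θ.toAddMonoidHom x
  map_add' := map_add (seriesExtend θ.toAddMonoidHom)
  map_smul' k x := by
    rw [Algebra.smul_def, seriesExtend_algebraMap_mul]
    exact FormalSeries.ext_coeff fun n => coeff_algebraMap_mul k _ n

/-- If the continuous extension of `θ` is surjective with kernel `J`, it identifies the quotient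
by `J` with a module of formal series. -/
theorem nonempty_quotient_linearEquiv (θ : F →ₗ[ℂ] MvPowerSeries (Fin ℓ) A)
    (J : TwoSidedIdeal (MvPowerSeries (Fin ℓ) F))
    (hsurj : Function.Surjective (seriesExtend θ.toAddMonoidHom))
    (hker : ∀ x, seriesExtend θ.toAddMonoidHom x = 0 ↔ x ∈ J) :
    Nonempty ((MvPowerSeries (Fin ℓ) F ⧸ J.asIdeal) ≃ₗ[FormalRing ℂ ℓ] FormalSeries ℓ A) := by
  have hK : J.asIdeal.restrictScalars (FormalRing ℂ ℓ) = LinearMap.ker (seriesExtendLinear θ) := by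
    ext x
    exact (hker x).symm
  exact ⟨(Submodule.Quotient.restrictScalarsEquiv (FormalRing ℂ ℓ) J.asIdeal).symm.trans
    ((Submodule.quotEquivOfEq _ _ hK).trans
      ((seriesExtendLinear θ).quotKerEquivOfSurjective hsurj))⟩

/-- A surjective ring homomorphism identifies the quotient by its kernel with its target. -/
theorem exists_quotient_ringEquiv {H A : Type*} [Ring H] [Ring A] (I : Ideal H) [I.IsTwoSided]
    (Φ : H →+* A) (hsurj : Function.Surjective Φ) (hker : ∀ a, Φ a = 0 ↔ a ∈ I) :
    ∃ φ : (H ⧸ I) ≃+* A, ∀ a, φ (Ideal.Quotient.mk I a) = Φ a := by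
  have hbij : Function.Bijective (Ideal.Quotient.lift I Φ fun a ha => (hker a).mpr ha) := by
    constructor
    · rw [injective_iff_map_eq_zero]
      intro a ha
      obtain ⟨a, rfl⟩ := Ideal.Quotient.mk_surjective a
      rw [Ideal.Quotient.lift_mk, hker] at ha
      exact Ideal.Quotient.eq_zero_iff_mem.mpr ha
    · intro a
      obtain ⟨x, rfl⟩ := hsurj a
      exact ⟨Ideal.Quotient.mk I x, rfl⟩
  exact ⟨RingEquiv.ofBijective _ hbij, fun _ => rfl⟩

end Quotients

end FormalDeformation

namespace SymplecticReflection

open FormalDeformation TensorAlgebra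

-- The flat deformation.

universe u v

/-- `H_c(V, G)` is a flat formal deformation of any quotient of `G ⋉ T(V)` in which the relations
of the Weyl algebra hold, and in which only constant terms of relations of `H_c(V, G)` vanish. -/
theorem exists_flatFormalDeformation {V : Type u} {G : Type v} [AddCommGroup V] [Module ℂ V]
    [FiniteDimensional ℂ V] [Group G] [Finite G] [DistribMulAction G V] [SMulCommClass G ℂ V]
    (ω : LinearMap.BilinForm ℂ V) (hω : ω.IsAlt) [PreservesForm G ω]
    {ℓ : ℕ} (b : Module.Basis (Fin ℓ) ℂ (invariantFunctions G V))
    {A : Type (max u v)} [Ring A] [Algebra ℂ A] (π : SmashTensor G V →ₐ[ℂ] A)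
    (hsurj : Function.Surjective π)
    (hπ : ∀ x y, π (SkewMonoidAlgebra.single 1 (ι ℂ x * ι ℂ y - ι ℂ y * ι ℂ x)) =
      algebraMap ℂ A (ω x y))
    (hlift : ∀ z, π z = 0 →
      ∃ y ∈ closedIdeal (relations ω 1 (formalParam b)), MvPowerSeries.coeff 0 y = z) :
    ∃ D : FlatFormalDeformation ℂ ℓ A (FormalSRA ω b),
      ∀ x, D.φ (Ideal.Quotient.mk _ (FormalSRA.mk ω b x)) =
        π (MvPowerSeries.constantCoeff x) := by
  have := Fintype.ofFinite G
  obtain ⟨θ, hθ₀, hθ⟩ := exists_deformedProj ω b hω π hπ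
  have hθ₀' : ∀ z, MvPowerSeries.coeff 0 (θ.toAddMonoidHom z) =
      (π : SmashTensor G V →+* A).toAddMonoidHom z := hθ₀
  have hJ : ∀ z ∈ closedIdeal (relations ω 1 (formalParam b)),
      seriesExtend θ.toAddMonoidHom z = 0 := fun z hz =>
    seriesExtend_eq_zero_of_mem_closedIdeal _
      (fun r hr p q => seriesExtend_relations ω b hθ hr p q) hz
  -- At exponent 0 the extension is π of the constant term, so π kills the constant terms of the
  -- closed ideal and descends to H_c(V, G).
  have hconst : ∀ z ∈ closedIdeal (relations ω 1 (formalParam b)),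
      π (MvPowerSeries.constantCoeff z) = 0 := by
    intro z hz
    have h := coeff_seriesExtend_eq_add hθ₀' z 0
    rw [hJ z hz] at h
    simpa using h.symm
  have hfree : IsTopologicallyFree ℂ ℓ (FormalSRA ω b) :=
    ⟨A, inferInstance, inferInstance, nonempty_quotient_linearEquiv θ _
      (seriesExtend_surjective hθ₀' hsurj) fun x =>
        ⟨mem_of_seriesExtend_eq_zero hθ₀' (isAdicallyClosed_closedIdeal _) hJ hlift, hJ x⟩⟩
  let Φ : FormalSRA ω b →+* A :=
    Ideal.Quotient.lift _ ((π : SmashTensor G V →+* A).comp MvPowerSeries.constantCoeff) hconst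
  have hΦ : ∀ x, Φ (FormalSRA.mk ω b x) = π (MvPowerSeries.constantCoeff x) := fun _ => rfl
  have hΦalg : ∀ k : FormalRing ℂ ℓ, Φ (algebraMap (FormalRing ℂ ℓ) (FormalSRA ω b) k) =
      algebraMap ℂ A (MvPowerSeries.constantCoeff k) := by
    intro k
    change π (MvPowerSeries.constantCoeff
      (algebraMap (FormalRing ℂ ℓ) (MvPowerSeries (Fin ℓ) (SmashTensor G V)) k)) = _
    rw [← MvPowerSeries.coeff_zero_eq_constantCoeff_apply, coeff_algebraMap, AlgHom.commutes,
      MvPowerSeries.coeff_zero_eq_constantCoeff_apply]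
  have hmax : ∀ a ∈ maxIdeal ℂ ℓ (FormalSRA ω b), Φ a = 0 := by
    have hle : maxIdeal ℂ ℓ (FormalSRA ω b) ≤ RingHom.ker Φ := by
      refine Ideal.map_le_iff_le_comap.mpr fun k hk => ?_
      rw [Ideal.mem_comap, RingHom.mem_ker, hΦalg]
      have hk' : MvPowerSeries.constantCoeff k = 0 := by
        by_contra h
        exact hk (MvPowerSeries.isUnit_iff_constantCoeff.mpr (isUnit_iff_ne_zero.mpr h))
      rw [hk', map_zero]
    exact fun a ha => hle ha
  have hker : ∀ a, Φ a = 0 ↔ a ∈ maxIdeal ℂ ℓ (FormalSRA ω b) := by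
    refine fun a => ⟨fun ha => ?_, hmax a⟩
    obtain ⟨x, rfl⟩ := Ideal.Quotient.mk_surjective a
    obtain ⟨y, hy, hyx⟩ := hlift _ ((hΦ x).symm.trans ha)
    -- Subtracting an element of the closed ideal with the same constant term leaves a combination
    -- of the ħ_i, which lies in 𝔪 H_c(V, G).
    obtain ⟨z, hz⟩ := exists_eq_sum_mul_X (x := x - y) (by
      rw [map_sub, hyx]
      exact sub_self _)
    have hxy : FormalSRA.mk ω b x = FormalSRA.mk ω b (x - y) := by
      rw [map_sub, Ideal.Quotient.eq_zero_iff_mem.mpr (TwoSidedIdeal.mem_asIdeal.mpr hy),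
        sub_zero]
    change FormalSRA.mk ω b x ∈ _
    rw [hxy, hz, map_sum]
    refine Ideal.sum_mem _ fun i _ => ?_
    rw [map_mul]
    refine Ideal.mul_mem_left _ _ ?_
    have hX : FormalSRA.mk ω b (MvPowerSeries.X i) =
        algebraMap (FormalRing ℂ ℓ) (FormalSRA ω b) (MvPowerSeries.X i) := by
      change _ = FormalSRA.mk ω b (MvPowerSeries.map _ _)
      rw [MvPowerSeries.map_X]
    rw [hX]
    refine Ideal.mem_map_of_mem _ ?_
    rw [IsLocalRing.mem_maximalIdeal, mem_nonunits_iff, MvPowerSeries.isUnit_iff_constantCoeff]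
    simp
  have hΦsurj : Function.Surjective Φ := by
    intro a
    obtain ⟨z, rfl⟩ := hsurj a
    refine ⟨FormalSRA.mk ω b (MvPowerSeries.C z), ?_⟩
    rw [hΦ, MvPowerSeries.constantCoeff_C]
  obtain ⟨φ, hφ⟩ := exists_quotient_ringEquiv _ Φ hΦsurj hker
  refine ⟨⟨hfree, φ, fun z => ?_⟩, fun x => ?_⟩
  · rw [hφ, hΦalg, MvPowerSeries.constantCoeff_C]
  · exact (hφ _).trans (hΦ x)

end SymplecticReflection

end

theorem mainTheorem2 {V G : Type*} [AddCommGroup V] [Module ℂ V] [FiniteDimensional ℂ V]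
    [Group G] [Finite G] [DistribMulAction G V] [SMulCommClass G ℂ V]
    (ω : LinearMap.BilinForm ℂ V) (hω_alt : ω.IsAlt) (hω_nondeg : ω.Nondegenerate)
    [SymplecticReflection.PreservesForm G ω]
    {ℓ : ℕ} (b : Module.Basis (Fin ℓ) ℂ (SymplecticReflection.invariantFunctions G V)) :
    ∃ D : FormalDeformation.FlatFormalDeformation ℂ ℓ
        (SymplecticReflection.SmashWeyl G ω) (SymplecticReflection.FormalSRA ω b),
      (∀ x : V,
        D.φ (Ideal.Quotient.mk _
          (SymplecticReflection.FormalSRA.mk ω b (SymplecticReflection.vec G ℓ x))) =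
        SkewMonoidAlgebra.single 1 (SymplecticReflection.Weyl.mk ω (TensorAlgebra.ι ℂ x))) ∧
      (∀ g : G,
        D.φ (Ideal.Quotient.mk _
          (SymplecticReflection.FormalSRA.mk ω b (SymplecticReflection.grp V ℓ g))) =
        SkewMonoidAlgebra.single g 1) := by
  let π : SymplecticReflection.SmashTensor G V →ₐ[ℂ] SymplecticReflection.SmashWeyl G ω :=
    { SymplecticReflection.smashProj ω with
      commutes' := fun z => by
        change SymplecticReflection.smashProj ω (SkewMonoidAlgebra.single 1 (algebraMap ℂ _ z)) = _
        rw [SymplecticReflection.smashProj_single, AlgHom.commutes]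
        rfl }
  have hπ : ∀ g a, π (SkewMonoidAlgebra.single g a) =
      SkewMonoidAlgebra.single g (SymplecticReflection.Weyl.mk ω a) :=
    SymplecticReflection.smashProj_single ω
  have hcomm : ∀ x y, π (SkewMonoidAlgebra.single 1
      (TensorAlgebra.ι ℂ x * TensorAlgebra.ι ℂ y - TensorAlgebra.ι ℂ y * TensorAlgebra.ι ℂ x)) =
      algebraMap ℂ _ (ω x y) := fun x y => by
    rw [hπ, SymplecticReflection.weyl_mk_commutator]
    rfl
  obtain ⟨D, hD⟩ := SymplecticReflection.exists_flatFormalDeformation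
    (A := SymplecticReflection.SmashWeyl G ω) ω hω_alt b π
    (SymplecticReflection.smashProj_surjective ω) hcomm
    (fun _ hz => SymplecticReflection.exists_mem_closedIdeal_of_smashProj_eq_zero ω b hz)
  refine ⟨D, fun x => ?_, fun g => ?_⟩
  · rw [hD, SymplecticReflection.vec, MvPowerSeries.constantCoeff_C, hπ]
  · rw [hD, SymplecticReflection.grp, MvPowerSeries.constantCoeff_C, hπ, map_one]
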